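/- Let $n\ge 2$, let $U\subset\mathbb R\times\mathbb R^n$ be a connected open set with coordinates $(t,x)=(t,x_1,\dots,x_n)$, and let $$\frac{dx_i}{dt}=f_i(x_1,\dots,x_n),\qquad i=1,\dots,n,$$ be an autonomous system with functions $f_i$ that are smooth and nowhere zero on $U$. Put $\ell_{ij}=f_j\,\partial(\ln|f_i|)/\partial x_j$ for $i\ne j$, and suppose that for some pair $i\neq j$ the function $\ell_{ij}$ has no zero on $U$ (up to renumbering the $x_i$, that $\ell_{12}\ne0$ on $U$). A web symmetry of the system on $U$ is a diffeomorphism $\Phi:U\to U$ of the form $$\Phi(t,x_1,\dots,x_n)=(\varphi_0(t),\varphi_1(x_1),\dots,\varphi_n(x_n)),$$ with inverse of the same form, such that $$\Phi^*(dx_i-f_i\,dt)=\sum_{j=1}^n a_{ij}\,(dx_j-f_j\,dt),\qquad i=1,\dots,n,$$ for a smooth function $[a_{ij}]:U\to \mathrm{GL}(n,\mathbb R)$. Then the group of all web symmetries of the system on $U$, with the compact-open topology, is a finite-dimensional (Hausdorff, second countable) Lie group of dimension at most $n+1$, and it acts smoothly on $U$. -/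

import Mathlib

open Set Topology Manifold TopologicalSpace
open scoped ContDiff

noncomputable section

/-- The space `ℝ × ℝⁿ` of the variables `(t, x)`, `x = (x₁, …, xₙ)`. -/
abbrev TX (n : ℕ) : Type := ℝ × (Fin n → ℝ)

/-- The one-form `dx_i - f_i(x) dt` at the point `p = (t, x)`. -/
def contactForm {n : ℕ} (f : (Fin n → ℝ) → Fin n → ℝ) (i : Fin n) (p : TX n) : TX n →L[ℝ] ℝ :=
  (ContinuousLinearMap.proj i).comp (ContinuousLinearMap.snd ℝ ℝ (Fin n → ℝ)) -
    f p.2 i • ContinuousLinearMap.fst ℝ ℝ (Fin n → ℝ)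

/-- The function `ℓ_{ij} = f_j ∂(ln |f_i|)/∂x_j`. -/
def ell {n : ℕ} (f : (Fin n → ℝ) → Fin n → ℝ) (i j : Fin n) (x : Fin n → ℝ) : ℝ :=
  f x j * fderiv ℝ (fun y => Real.log |f y i|) x (Pi.single j 1)

/-- `Φ(t, x₁, …, xₙ) = (φ₀(t), φ₁(x₁), …, φₙ(xₙ))` on `U`. -/
def IsWebMap {n : ℕ} {U : Opens (TX n)} (Φ : U → U) : Prop :=
  ∃ (φ₀ : ℝ → ℝ) (φ : Fin n → ℝ → ℝ), ∀ p : U,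
    (Φ p : TX n) = (φ₀ p.1.1, fun i => φ i (p.1.2 i))

/-- `Φ` is a symmetry of the system `dx_i/dt = f_i(x)`:
`Φ^*(dx_i - f_i dt) = ∑ j, a_{ij} (dx_j - f_j dt)` for a smooth function
`[a_{ij}] : U → GL(n, ℝ)`. -/
def PreservesSystem {n : ℕ} (f : (Fin n → ℝ) → Fin n → ℝ) {U : Opens (TX n)} (Φ : U → U) : Prop :=
  ∃ a : U → Matrix (Fin n) (Fin n) ℝ,
    (∀ i j, ContMDiff 𝓘(ℝ, TX n) 𝓘(ℝ, ℝ) ∞ (fun p => a p i j)) ∧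
    (∀ p, IsUnit (a p).det) ∧
    ∀ (p : U) (i : Fin n) (v : TX n),
      contactForm f i (Φ p) (mfderiv 𝓘(ℝ, TX n) 𝓘(ℝ, TX n) Φ p v) =
        ∑ j, a p i j * contactForm f j p v

/-- Web symmetries of the system on `U`: diffeomorphisms of `U` which, with their inverses, have the
form of a web transformation, and which preserve the system. -/
structure IsWebSymmetry {n : ℕ} (f : (Fin n → ℝ) → Fin n → ℝ) {U : Opens (TX n)}
    (Φ : U ≃ₜ U) : Prop where
  smooth : ContMDiff 𝓘(ℝ, TX n) 𝓘(ℝ, TX n) ∞ Φ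
  smooth_symm : ContMDiff 𝓘(ℝ, TX n) 𝓘(ℝ, TX n) ∞ Φ.symm
  web : IsWebMap Φ
  web_symm : IsWebMap Φ.symm
  preserves : PreservesSystem f Φ

theorem IsWebMap.comp {n : ℕ} {U : Opens (TX n)} {Φ Ψ : U → U} (hΦ : IsWebMap Φ)
    (hΨ : IsWebMap Ψ) : IsWebMap (Φ ∘ Ψ) := by
  obtain ⟨φ₀, φ, h⟩ := hΦ
  obtain ⟨ψ₀, ψ, k⟩ := hΨ
  refine ⟨φ₀ ∘ ψ₀, fun i => φ i ∘ ψ i, fun p => ?_⟩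
  simp [h, k]

theorem PreservesSystem.comp {n : ℕ} {f : (Fin n → ℝ) → Fin n → ℝ} {U : Opens (TX n)}
    {Φ Ψ : U → U} (hΦ : PreservesSystem f Φ) (hΨ : PreservesSystem f Ψ)
    (sΦ : ContMDiff 𝓘(ℝ, TX n) 𝓘(ℝ, TX n) ∞ Φ) (sΨ : ContMDiff 𝓘(ℝ, TX n) 𝓘(ℝ, TX n) ∞ Ψ) :
    PreservesSystem f (Φ ∘ Ψ) := by
  obtain ⟨a, ha, hda, h⟩ := hΦ
  obtain ⟨b, hb, hdb, k⟩ := hΨ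
  refine ⟨fun p => a (Ψ p) * b p, fun i j => ?_, fun p => ?_, fun p i v => ?_⟩
  · simp only [Matrix.mul_apply]
    exact contMDiff_finsetSum fun l _ => ((ha i l).comp sΨ).mul (hb l j)
  · rw [Matrix.det_mul]; exact (hda _).mul (hdb _)
  · have hc := mfderiv_comp p (sΦ.mdifferentiable (by simp) (Ψ p)) (sΨ.mdifferentiable (by simp) p)
    rw [hc]
    have h1 := h (Ψ p) i (mfderiv 𝓘(ℝ, TX n) 𝓘(ℝ, TX n) Ψ p v)
    refine h1.trans ?_
    simp only [k, Matrix.mul_apply, Finset.mul_sum, Finset.sum_mul]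
    rw [Finset.sum_comm]
    simp only [mul_assoc]

theorem contMDiff_det_of_entries {n : ℕ} {U : Opens (TX n)} {a : U → Matrix (Fin n) (Fin n) ℝ}
    (ha : ∀ i j, ContMDiff 𝓘(ℝ, TX n) 𝓘(ℝ, ℝ) ∞ (fun p => a p i j)) :
    ContMDiff 𝓘(ℝ, TX n) 𝓘(ℝ, ℝ) ∞ (fun p => (a p).det) := by
  simp only [Matrix.det_apply']
  exact contMDiff_finsetSum fun σ _ => contMDiff_const.mul
    (contMDiff_finsetProd fun i _ => ha _ _)

theorem PreservesSystem.symm {n : ℕ} {f : (Fin n → ℝ) → Fin n → ℝ} {U : Opens (TX n)}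
    {Φ : U ≃ₜ U} (hΦ : PreservesSystem f Φ)
    (s : ContMDiff 𝓘(ℝ, TX n) 𝓘(ℝ, TX n) ∞ Φ)
    (s' : ContMDiff 𝓘(ℝ, TX n) 𝓘(ℝ, TX n) ∞ Φ.symm) :
    PreservesSystem f Φ.symm := by
  obtain ⟨a, ha, hda, h⟩ := hΦ
  refine ⟨fun p => (a (Φ.symm p))⁻¹, fun i j => ?_, fun p => ?_, fun p i v => ?_⟩
  · have key : ContMDiff 𝓘(ℝ, TX n) 𝓘(ℝ, ℝ) ∞ (fun p => (a p)⁻¹ i j) := by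
      simp only [Matrix.inv_def, Ring.inverse_eq_inv', Matrix.smul_apply, smul_eq_mul,
        Matrix.adjugate_apply]
      refine ((contMDiff_det_of_entries ha).inv₀ fun p => (hda p).ne_zero).mul
        (contMDiff_det_of_entries fun k l => ?_)
      simp only [Matrix.updateRow_apply]
      split_ifs
      · exact contMDiff_const
      · exact ha k l
    exact key.comp s'
  · exact Matrix.isUnit_nonsing_inv_det _ (hda _)
  · set w : TX n := mfderiv 𝓘(ℝ, TX n) 𝓘(ℝ, TX n) Φ.symm p v with hw
    have hc := mfderiv_comp p (s.mdifferentiable (by simp) (Φ.symm p))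
      (s'.mdifferentiable (by simp) p)
    have hid : (Φ : U → U) ∘ Φ.symm = id := by ext1 x; simp
    rw [hid, mfderiv_id] at hc
    have hv : mfderiv 𝓘(ℝ, TX n) 𝓘(ℝ, TX n) Φ (Φ.symm p) w = v :=
      (DFunLike.congr_fun hc v).symm
    have h1 : ∀ j, contactForm f j p v = ∑ l, a (Φ.symm p) j l * contactForm f l (Φ.symm p) w := by
      intro j
      have := h (Φ.symm p) j w
      rw [hv] at this
      simpa using this
    have h2 : (fun j => contactForm f j p v) =
        (a (Φ.symm p)).mulVec (fun l => contactForm f l (Φ.symm p) w) := funext h1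
    have h3 : (fun l => contactForm f l (Φ.symm p) w) =
        (a (Φ.symm p))⁻¹.mulVec (fun j => contactForm f j p v) := by
      rw [h2, Matrix.mulVec_mulVec, Matrix.nonsing_inv_mul _ (hda _), Matrix.one_mulVec]
    exact congrFun h3 i

/-- The web symmetries form a group under composition. -/
def webSymmetrySubgroup {n : ℕ} (f : (Fin n → ℝ) → Fin n → ℝ) (U : Opens (TX n)) :
    Subgroup (U ≃ₜ U) where
  carrier := {Φ | IsWebSymmetry f Φ}
  mul_mem' {Φ Ψ} hΦ hΨ :=
    { smooth := hΦ.smooth.comp hΨ.smooth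
      smooth_symm := hΨ.smooth_symm.comp hΦ.smooth_symm
      web := hΦ.web.comp hΨ.web
      web_symm := hΨ.web_symm.comp hΦ.web_symm
      preserves := hΦ.preserves.comp hΨ.preserves hΦ.smooth hΨ.smooth }
  one_mem' :=
    { smooth := contMDiff_id
      smooth_symm := contMDiff_id
      web := ⟨id, fun _ => id, fun _ => rfl⟩
      web_symm := ⟨id, fun _ => id, fun _ => rfl⟩
      preserves := by
        refine ⟨fun _ => 1, fun i j => contMDiff_const, fun p => by simp, fun p i v => ?_⟩
        have : mfderiv 𝓘(ℝ, TX n) 𝓘(ℝ, TX n) (⇑(1 : U ≃ₜ U)) p v = v :=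
          DFunLike.congr_fun (mfderiv_id (I := 𝓘(ℝ, TX n)) (x := p)) v
        rw [this]
        simp [Matrix.one_apply] }
  inv_mem' {Φ} hΦ :=
    { smooth := hΦ.smooth_symm
      smooth_symm := hΦ.smooth
      web := hΦ.web_symm
      web_symm := hΦ.web
      preserves := hΦ.preserves.symm hΦ.smooth hΦ.smooth_symm }

/-- The web symmetry group on `U` of the system `dx_i/dt = f_i(x)`. -/
abbrev WebSymmetryGroup {n : ℕ} (f : (Fin n → ℝ) → Fin n → ℝ) (U : Opens (TX n)) : Type :=
  webSymmetrySubgroup f U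

/-- The compact-open topology on the web symmetry group. -/
instance webSymmetryGroupTopology {n : ℕ} (f : (Fin n → ℝ) → Fin n → ℝ) (U : Opens (TX n)) :
    TopologicalSpace (WebSymmetryGroup f U) :=
  TopologicalSpace.induced (fun g => (⟨g.1, g.1.continuous⟩ : C(U, U))) inferInstance

end

/-! The vector `(1, f)` is annihilated by all the forms `dx_i - f_i dt`, so a symmetry satisfies
`φ_i'(x_i) f_i(x) = φ₀'(t) f_i(Φ(x))`. Differentiating in `x_j`, `j ≠ i`, and dividing gives `φ₀'(t)
ℓ_ij(Φ(x)) = ℓ_ij(x)`. Since `ℓ_ij` has no zero and does not involve `t`, the slope `φ₀'` is locally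
a constant `κ`, fixed by one point and its image. Each `φ_k` then solves the separable equation
`φ_k'(u) = κ f_k(…, φ_k(u), …) / f_k(…, u, …)`, which is solved by primitives of `1 / f_k`. So near
any point a symmetry is given by a smooth formula `g y = E (x, g x, y)`
(`hasLocalFormula_webSymmetry`), and limits of symmetries are symmetries (`rigidGroup_webSymmetry`).

The rest concerns any such rigid group on a connected open set. Two elements that agree at one point
are equal, and convergence at one point forces convergence everywhere. Hence the orbit map `g ↦ g o`
is an embedding for the compact-open topology, and its image is closed in `U` (`isEmbedding_apply`,
`isClosed_range_apply`).

Smoothness of the orbit follows the pattern of Cartan's closed subgroup theorem, with the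
displacement `a g = g o - o` in place of a logarithm. It is additive up to an error `C ‖a g‖ ‖a h‖`.
Limit directions of small displacements form a linear space `T`, by taking powers; projection to `T`
is injective on the orbit near `o`, and it is onto a neighbourhood of `0` by minimising a distance
on a compact set. The inverse section `σ` satisfies `σ' = A(σ)` with `A` smooth, hence is smooth.
Left translates of this section are the charts, and `dim T ≤ dim (ℝ × ℝⁿ) = n + 1`. -/

/-! ### Nearly additive maps from a group to a finite-dimensional space -/

/-- A map from a group to a normed space which is additive up to a quadratic error near the
identity and whose image is locally compact there. -/
structure NearlyAdditive {G W : Type*} [Group G] [NormedAddCommGroup W] (a : G → W) (C r : ℝ) :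
    Prop where
  C_nonneg : 0 ≤ C
  r_pos : 0 < r
  map_one : a 1 = 0
  map_mul : ∀ g h, ‖a g‖ < r → ‖a h‖ < r → ‖a (g * h) - a g - a h‖ ≤ C * ‖a g‖ * ‖a h‖
  map_inv : ∀ g, ‖a g‖ < r → ‖a g⁻¹‖ ≤ 2 * ‖a g‖
  compact : ∀ s < r, IsCompact (range a ∩ Metric.closedBall 0 s)

namespace NearlyAdditive

set_option linter.unusedSectionVars false

open Filter

variable {G W : Type*} [Group G] [NormedAddCommGroup W] [NormedSpace ℝ W] {a : G → W} {C r : ℝ}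

/-- With `ε = ‖a g‖`, the bound `C m ε ≤ 1` keeps `‖a (g ^ m)‖ ≤ 2 m ε`, so one more factor adds an
error of at most `2 C m ε²`, and these errors sum to less than `C (m ε)²`. -/
theorem norm_pow_sub_le (ha : NearlyAdditive a C r) (g : G) (hg : ‖a g‖ < r) (m : ℕ)
    (hm : 2 * (m * ‖a g‖) < r) (hC : C * (m * ‖a g‖) ≤ 1) :
    ‖a (g ^ m) - (m : ℝ) • a g‖ ≤ C * (m * ‖a g‖) ^ 2 := by
  have hC0 := ha.C_nonneg
  induction m with
  | zero => simp [ha.map_one]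
  | succ m ih =>
    have hn := norm_nonneg (a g)
    have hle : (m : ℝ) * ‖a g‖ ≤ ((m + 1 : ℕ) : ℝ) * ‖a g‖ := by
      push_cast; nlinarith
    have h0 : 0 ≤ (m : ℝ) * ‖a g‖ := by positivity
    have hC' : C * (m * ‖a g‖) ≤ 1 := (mul_le_mul_of_nonneg_left hle hC0).trans hC
    have ih := ih (by linarith) hC'
    have hb : ‖a (g ^ m)‖ ≤ 2 * (m * ‖a g‖) := by
      have h1 : ‖a (g ^ m)‖ ≤ ‖a (g ^ m) - (m : ℝ) • a g‖ + ‖(m : ℝ) • a g‖ := by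
        simpa using norm_add_le (a (g ^ m) - (m : ℝ) • a g) ((m : ℝ) • a g)
      rw [norm_smul, Real.norm_natCast] at h1
      nlinarith [mul_le_mul_of_nonneg_right hC' h0]
    have h2 := ha.map_mul (g ^ m) g (by linarith) hg
    have h3 : a (g ^ (m + 1)) - ((m + 1 : ℕ) : ℝ) • a g =
        (a (g ^ m * g) - a (g ^ m) - a g) + (a (g ^ m) - (m : ℝ) • a g) := by
      rw [pow_succ]; push_cast; module
    rw [h3]
    refine (norm_add_le _ _).trans ?_
    have h4 : C * ‖a (g ^ m)‖ * ‖a g‖ ≤ C * (2 * (m * ‖a g‖)) * ‖a g‖ := by gcongr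
    push_cast
    nlinarith [mul_nonneg hC0 (mul_nonneg hn hn)]

/-- The vectors along which the image is tangent at the origin, to second order. -/
def IsTangent (a : G → W) (v : W) : Prop :=
  ∃ B : ℝ, 0 ≤ B ∧ ∃ δ > 0, ∀ s : ℝ, 0 < s → s < δ → ∃ g, ‖a g - s • v‖ ≤ B * s ^ 2

theorem norm_le_of_approx {w v : W} {s B : ℝ} (hs : 0 < s) (h : ‖w - s • v‖ ≤ B * s ^ 2)
    (h1 : s < 1) (hB : 0 ≤ B) : ‖w‖ ≤ s * (‖v‖ + B) := by
  have h2 : ‖w‖ ≤ ‖w - s • v‖ + ‖s • v‖ := by simpa using norm_add_le (w - s • v) (s • v)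
  rw [norm_smul, Real.norm_of_nonneg hs.le] at h2
  nlinarith [mul_nonneg hB hs.le]

/-- For given `s`, take `k` large and the power `m = ⌊s / ‖a (g k)‖⌋`; then `a (g k ^ m) ≈ m a (g k)
≈ s v`. -/
theorem isTangent_of_tendsto (ha : NearlyAdditive a C r) {g : ℕ → G} {v : W}
    (h0 : ∀ k, a (g k) ≠ 0) (hg : Tendsto (fun k => ‖a (g k)‖) atTop (𝓝 0))
    (hv : Tendsto (fun k => ‖a (g k)‖⁻¹ • a (g k)) atTop (𝓝 v)) : IsTangent a v := by
  have hC0 := ha.C_nonneg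
  have hr := ha.r_pos
  -- Three errors are collected: `C s²` from near additivity, `s²` from rounding `m` (the step
  -- length is below `s²`), and `s²` from the direction, which is within `s` of `v`. The index `k`
  -- may depend on `s`; the constant does not.
  refine ⟨C + 2, by linarith, min (r / 2) (1 / (C + 1)), by positivity, fun s hs hsδ => ?_⟩
  have hsr : 2 * s < r := by linarith [hsδ.trans_le (min_le_left _ _)]
  have hsC : C * s ≤ 1 := by
    have := hsδ.trans_le (min_le_right _ _)
    rw [lt_div_iff₀ (by linarith)] at this
    linarith
  have e1 : ∀ᶠ k in atTop, ‖a (g k)‖ < min (s ^ 2) r :=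
    hg.eventually (gt_mem_nhds (by positivity))
  have e2 : ∀ᶠ k in atTop, ‖‖a (g k)‖⁻¹ • a (g k) - v‖ < s := by
    have := (tendsto_iff_norm_sub_tendsto_zero.1 hv).eventually (gt_mem_nhds hs)
    exact this
  obtain ⟨k, hk1, hk2⟩ := (e1.and e2).exists
  set ε := ‖a (g k)‖ with hε
  have hεpos : 0 < ε := norm_pos_iff.2 (h0 k)
  set u := ε⁻¹ • a (g k) with hu
  have hau : a (g k) = ε • u := by rw [hu, smul_smul, mul_inv_cancel₀ hεpos.ne', one_smul]
  have hunorm : ‖u‖ = 1 := by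
    rw [hu, norm_smul, norm_inv, Real.norm_of_nonneg hεpos.le, ← hε, inv_mul_cancel₀ hεpos.ne']
  set m := ⌊s / ε⌋₊ with hm
  have hm1 : m * ε ≤ s := by
    have := Nat.floor_le (div_nonneg hs.le hεpos.le)
    rwa [le_div_iff₀ hεpos] at this
  have hm2 : s < m * ε + ε := by
    have := Nat.lt_floor_add_one (s / ε)
    rw [div_lt_iff₀ hεpos] at this
    linarith
  have hm0 : 0 ≤ m * ε := by positivity
  have key := ha.norm_pow_sub_le (g k) (hk1.trans_le (min_le_right _ _)) m
    (by rw [← hε]; linarith)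
    (by rw [← hε]; exact (mul_le_mul_of_nonneg_left hm1 hC0).trans hsC)
  rw [← hε] at key
  refine ⟨g k ^ m, ?_⟩
  have h3 : a (g k ^ m) - s • v =
      (a (g k ^ m) - (m : ℝ) • a (g k)) + ((m * ε - s) • u + s • (u - v)) := by
    rw [hau]; module
  rw [h3]
  have h4 : ‖(m * ε - s) • u‖ ≤ s ^ 2 := by
    rw [norm_smul, hunorm, mul_one, Real.norm_eq_abs, abs_le]
    have := hk1.le.trans (min_le_left _ _)
    constructor <;> nlinarith
  have h5 : ‖s • (u - v)‖ ≤ s ^ 2 := by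
    rw [norm_smul, Real.norm_of_nonneg hs.le, sq]
    gcongr
  have h6 : C * (m * ε) ^ 2 ≤ C * s ^ 2 := by gcongr
  calc _ ≤ C * s ^ 2 + (s ^ 2 + s ^ 2) :=
        (norm_add_le _ _).trans (add_le_add (key.trans h6)
          ((norm_add_le _ _).trans (add_le_add h4 h5)))
    _ = _ := by ring

theorem IsTangent.add (ha : NearlyAdditive a C r) {v w : W} (hv : IsTangent a v)
    (hw : IsTangent a w) : IsTangent a (v + w) := by
  obtain ⟨B, hB, δ, hδ, h⟩ := hv
  obtain ⟨B', hB', δ', hδ', h'⟩ := hw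
  have hC0 := ha.C_nonneg
  have hr := ha.r_pos
  set D := ‖v‖ + B + (‖w‖ + B') + 1 with hD
  have hDpos : 0 < D := by positivity
  refine ⟨B + B' + C * D * D, by positivity, min (min δ δ') (min 1 (r / D)), by positivity,
    fun s hs hsδ => ?_⟩
  have s1 := hsδ.trans_le ((min_le_left _ _).trans (min_le_left _ _))
  have s2 := hsδ.trans_le ((min_le_left _ _).trans (min_le_right _ _))
  have s3 := hsδ.trans_le ((min_le_right _ _).trans (min_le_left _ _))
  have s4 := hsδ.trans_le ((min_le_right _ _).trans (min_le_right _ _))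
  rw [lt_div_iff₀ hDpos] at s4
  obtain ⟨g, hg⟩ := h s hs s1
  obtain ⟨k, hk⟩ := h' s hs s2
  have ng : ‖a g‖ ≤ s * D := (norm_le_of_approx hs hg s3 hB).trans (by
    gcongr; linarith [norm_nonneg w])
  have nk : ‖a k‖ ≤ s * D := (norm_le_of_approx hs hk s3 hB').trans (by
    gcongr; linarith [norm_nonneg v])
  have key := ha.map_mul g k (ng.trans_lt s4) (nk.trans_lt s4)
  refine ⟨g * k, ?_⟩
  have h3 : a (g * k) - s • (v + w) =
      (a (g * k) - a g - a k) + ((a g - s • v) + (a k - s • w)) := by module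
  have h4 : C * ‖a g‖ * ‖a k‖ ≤ C * (s * D) * (s * D) := by gcongr
  rw [h3]
  calc _ ≤ C * (s * D) * (s * D) + (B * s ^ 2 + B' * s ^ 2) :=
        (norm_add_le _ _).trans (add_le_add (key.trans h4)
          ((norm_add_le _ _).trans (add_le_add hg hk)))
    _ = _ := by ring

theorem IsTangent.neg (ha : NearlyAdditive a C r) {v : W} (hv : IsTangent a v) :
    IsTangent a (-v) := by
  obtain ⟨B, hB, δ, hδ, h⟩ := hv
  have hC0 := ha.C_nonneg
  have hr := ha.r_pos
  set D := ‖v‖ + B + 1 with hD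
  have hDpos : 0 < D := by positivity
  refine ⟨B + 2 * C * D * D, by positivity, min δ (min 1 (r / (2 * D))), by positivity,
    fun s hs hsδ => ?_⟩
  have s1 := hsδ.trans_le (min_le_left _ _)
  have s3 := hsδ.trans_le ((min_le_right _ _).trans (min_le_left _ _))
  have s4 := hsδ.trans_le ((min_le_right _ _).trans (min_le_right _ _))
  rw [lt_div_iff₀ (by positivity)] at s4
  obtain ⟨g, hg⟩ := h s hs s1
  have ng : ‖a g‖ ≤ s * D := (norm_le_of_approx hs hg s3 hB).trans (by gcongr; linarith)
  have ng' : ‖a g⁻¹‖ ≤ 2 * (s * D) := (ha.map_inv g (by nlinarith)).trans (by gcongr)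
  have key := ha.map_mul g g⁻¹ (by nlinarith) (by nlinarith)
  rw [mul_inv_cancel, ha.map_one] at key
  refine ⟨g⁻¹, ?_⟩
  have h3 : a g⁻¹ - s • (-v) = -(0 - a g - a g⁻¹) - (a g - s • v) := by module
  have h4 : C * ‖a g‖ * ‖a g⁻¹‖ ≤ C * (s * D) * (2 * (s * D)) := by gcongr
  rw [h3]
  calc _ ≤ C * (s * D) * (2 * (s * D)) + B * s ^ 2 := by
        refine (norm_sub_le _ _).trans (add_le_add ?_ hg)
        rw [norm_neg]; exact key.trans h4
    _ = _ := by ring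

theorem IsTangent.zero (ha : NearlyAdditive a C r) : IsTangent a 0 :=
  ⟨0, le_rfl, 1, one_pos, fun s _ _ => ⟨1, by simp [ha.map_one]⟩⟩

theorem IsTangent.pos_smul {v : W} (hv : IsTangent a v) {c : ℝ} (hc : 0 < c) :
    IsTangent a (c • v) := by
  obtain ⟨B, hB, δ, hδ, h⟩ := hv
  refine ⟨B * c ^ 2, by positivity, δ / c, by positivity, fun s hs hsδ => ?_⟩
  rw [lt_div_iff₀ hc] at hsδ
  obtain ⟨g, hg⟩ := h (s * c) (by positivity) hsδ
  refine ⟨g, ?_⟩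
  rw [smul_smul]
  exact hg.trans (by rw [mul_pow]; linarith)

/-- The tangent space at the origin of the image of a nearly additive map. -/
def tangentSpace (ha : NearlyAdditive a C r) : Submodule ℝ W where
  carrier := {v | IsTangent a v}
  add_mem' hv hw := IsTangent.add ha hv hw
  zero_mem' := IsTangent.zero ha
  smul_mem' c v hv := by
    rcases lt_trichotomy c 0 with hc | rfl | hc
    · have := IsTangent.neg ha (hv.pos_smul (neg_pos.2 hc))
      simpa using this
    · simpa using IsTangent.zero ha
    · exact hv.pos_smul hc

variable [FiniteDimensional ℝ W]

/-- Otherwise the normalised counterexamples would have a limit on the compact unit sphere. That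
limit is tangent, hence fixed by `P`, although the failing inequality keeps it away from its
projection. -/
theorem norm_sub_proj_le (ha : NearlyAdditive a C r) (P : W →L[ℝ] ha.tangentSpace)
    (hP : ∀ v : ha.tangentSpace, P v = v) {ε : ℝ} (hε : 0 < ε) :
    ∃ δ > 0, ∀ g, ‖a g‖ < δ → ‖a g - P (a g)‖ ≤ ε * ‖a g‖ := by
  by_contra! hcon
  have hk : ∀ k : ℕ, (0 : ℝ) < 1 / (k + 1) := fun k => by positivity
  choose g hg1 hg2 using fun k : ℕ => hcon _ (hk k)
  have h0 : ∀ k, a (g k) ≠ 0 := by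
    intro k hk0
    have := hg2 k
    simp [hk0] at this
  set u : ℕ → W := fun k => ‖a (g k)‖⁻¹ • a (g k) with hu
  have hsph : ∀ k, u k ∈ Metric.sphere (0 : W) 1 := fun k => by
    simp [hu, norm_smul, h0 k]
  obtain ⟨v, -, θ, hθ, hlim⟩ := (isCompact_sphere (0 : W) 1).tendsto_subseq hsph
  have ht0 : Tendsto (fun k => ‖a (g k)‖) atTop (𝓝 0) :=
    squeeze_zero (fun k => norm_nonneg _) (fun k => (hg1 k).le)
      tendsto_one_div_add_atTop_nhds_zero_nat
  have hv : IsTangent a v := ha.isTangent_of_tendsto (g := g ∘ θ) (fun k => h0 _)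
    (ht0.comp hθ.tendsto_atTop) hlim
  have hcont : Tendsto (fun k => ‖u (θ k) - P (u (θ k))‖) atTop (𝓝 ‖v - P v‖) := by
    have hc : Continuous fun w : W => ‖w - (P w : W)‖ := by fun_prop
    exact (hc.tendsto v).comp hlim
  have hge : ∀ k, ε ≤ ‖u (θ k) - P (u (θ k))‖ := by
    intro k
    have hpos : 0 < ‖a (g (θ k))‖ := norm_pos_iff.2 (h0 _)
    have : u (θ k) - P (u (θ k)) =
        ‖a (g (θ k))‖⁻¹ • (a (g (θ k)) - P (a (g (θ k)))) := by
      simp [hu, smul_sub]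
    rw [this, norm_smul, norm_inv, norm_norm, inv_mul_eq_div, le_div_iff₀ hpos]
    exact (hg2 _).le
  have h1 := ge_of_tendsto' hcont hge
  have h2 : (P v : W) = v := congrArg Subtype.val (hP ⟨v, hv⟩)
  rw [h2, sub_self, norm_zero] at h1
  linarith

theorem exists_norm_le_proj (ha : NearlyAdditive a C r) (P : W →L[ℝ] ha.tangentSpace)
    (hP : ∀ v : ha.tangentSpace, P v = v) :
    ∃ δ > 0, ∀ g, ‖a g‖ < δ → ‖a g‖ ≤ 2 * ‖P (a g)‖ := by
  obtain ⟨δ, hδ, h⟩ := ha.norm_sub_proj_le P hP (ε := 1 / 2) (by norm_num)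
  refine ⟨δ, hδ, fun g hg => ?_⟩
  have h1 := h g hg
  have h2 : ‖a g‖ ≤ ‖a g - P (a g)‖ + ‖(P (a g) : W)‖ := by
    simpa using norm_add_le (a g - P (a g)) (P (a g) : W)
  rw [Submodule.coe_norm] at *
  linarith

/-- Minimise the distance from `P w` to `z` over the compact part of the image. If the defect `u = z
- P w` were nonzero, multiplying by an element with displacement about `τ u` would reduce it. -/
theorem exists_proj_eq (ha : NearlyAdditive a C r) (P : W →L[ℝ] ha.tangentSpace)
    (hP : ∀ v : ha.tangentSpace, P v = v) :
    ∃ ρ > 0, ∀ z : ha.tangentSpace, ‖z‖ < ρ → ∃ g, ‖a g‖ ≤ 4 * ‖z‖ ∧ P (a g) = z := by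
  obtain ⟨δ, hδ, hδ'⟩ := ha.exists_norm_le_proj P hP
  have hC0 := ha.C_nonneg
  have hr := ha.r_pos
  have hPn := norm_nonneg P
  set s := min (min (δ / 2) (r / 2)) (1 / (2 * (‖P‖ * C + 1))) with hs
  have hspos : 0 < s := by positivity
  have sδ : s < δ := by
    have := (min_le_left (min (δ / 2) (r / 2)) (1 / (2 * (‖P‖ * C + 1)))).trans (min_le_left _ _)
    linarith
  have sr : s < r := by
    have := (min_le_left (min (δ / 2) (r / 2)) (1 / (2 * (‖P‖ * C + 1)))).trans (min_le_right _ _)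
    linarith
  -- This makes the multiplicative error cost at most half of the gain `τ ‖u‖`, up to terms of order
  -- `τ²`.
  have sP : ‖P‖ * C * s ≤ 1 / 2 := by
    have := min_le_right (min (δ / 2) (r / 2)) (1 / (2 * (‖P‖ * C + 1)))
    rw [← hs, le_div_iff₀ (by positivity)] at this
    nlinarith
  -- As the minimiser satisfies `‖w‖ ≤ 4 ‖z‖ < s`, it lies strictly inside the ball, so small moves
  -- remain admissible.
  refine ⟨s / 4, by positivity, fun z hz => ?_⟩
  obtain ⟨w, ⟨⟨g, hgw⟩, hws⟩, hmin⟩ := (ha.compact s sr).exists_isMinOn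
    ⟨0, ⟨1, ha.map_one⟩, by simp [hspos.le]⟩
    (f := fun w => ‖P w - z‖) (by fun_prop)
  have hmin' : ∀ k, ‖a k‖ ≤ s → ‖P w - z‖ ≤ ‖P (a k) - z‖ := fun k hk =>
    hmin ⟨⟨k, rfl⟩, by simpa using hk⟩
  have hws' : ‖w‖ ≤ s := by simpa using hws
  have h1 : ‖P w - z‖ ≤ ‖z‖ := by
    have := hmin' 1 (by simp [ha.map_one, hspos.le])
    simpa [ha.map_one] using this
  have h2 : ‖P w‖ ≤ 2 * ‖z‖ := by
    have : ‖P w‖ ≤ ‖P w - z‖ + ‖z‖ := by simpa using norm_add_le (P w - z) z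
    linarith
  have h3 : ‖w‖ ≤ 4 * ‖z‖ := by
    have := hδ' g (by rw [hgw]; linarith)
    rw [hgw] at this
    linarith
  refine ⟨g, by rwa [hgw], ?_⟩
  rw [hgw]
  by_contra hne
  set u : ha.tangentSpace := z - P w with hu
  have hupos : 0 < ‖u‖ := by
    rw [norm_pos_iff, hu, sub_ne_zero]; exact fun h => hne h.symm
  obtain ⟨B, hB, δ', hδ'pos, hT⟩ : IsTangent a (u : W) := u.2
  have hwlt : 0 < s - ‖w‖ := by linarith
  set D := ‖(u : W)‖ + B with hD
  have hDpos : 0 < D := by have : ‖(u : W)‖ = ‖u‖ := rfl; positivity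
  have hev : ∀ᶠ τ : ℝ in 𝓝[>] 0, 0 < τ ∧ τ < δ' ∧ τ < 1 ∧ τ * D < r ∧
      τ * D + C * s * (τ * D) < s - ‖w‖ ∧ τ * ((‖P‖ + ‖P‖ * C * s) * B) < ‖u‖ / 2 := by
    have t1 : Tendsto (fun τ : ℝ => τ * D) (𝓝[>] 0) (𝓝 0) :=
      (Continuous.tendsto' (by fun_prop) _ _ (by simp)).mono_left nhdsWithin_le_nhds
    have t2 : Tendsto (fun τ : ℝ => τ * D + C * s * (τ * D)) (𝓝[>] 0) (𝓝 0) :=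
      (Continuous.tendsto' (by fun_prop) _ _ (by simp)).mono_left nhdsWithin_le_nhds
    have t3 : Tendsto (fun τ : ℝ => τ * ((‖P‖ + ‖P‖ * C * s) * B)) (𝓝[>] 0) (𝓝 0) :=
      (Continuous.tendsto' (by fun_prop) _ _ (by simp)).mono_left nhdsWithin_le_nhds
    filter_upwards [self_mem_nhdsWithin, nhdsWithin_le_nhds (gt_mem_nhds hδ'pos),
      nhdsWithin_le_nhds (gt_mem_nhds (one_pos (α := ℝ))), t1.eventually (gt_mem_nhds hr),
      t2.eventually (gt_mem_nhds hwlt),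
      t3.eventually (gt_mem_nhds (half_pos hupos))] with τ q1 q2 q3 q4 q5 q6
    exact ⟨q1, q2, q3, q4, q5, q6⟩
  obtain ⟨τ, τ0, τδ, τ1, τr, τs, τu⟩ := hev.exists
  obtain ⟨k, hk⟩ := hT τ τ0 τδ
  have nk : ‖a k‖ ≤ τ * D := norm_le_of_approx τ0 hk τ1 hB
  have hmul := ha.map_mul g k (by rw [hgw]; linarith) (by linarith)
  rw [hgw] at hmul
  set e := a (g * k) - w - a k with he
  have hek : a (g * k) = w + a k + e := by rw [he]; abel
  have hne' : ‖e‖ ≤ C * s * ‖a k‖ := hmul.trans (by gcongr)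
  have hle : ‖a (g * k)‖ ≤ s := by
    rw [hek]
    have : ‖e‖ ≤ C * s * (τ * D) := hne'.trans (by gcongr)
    have := norm_add₃_le (a := w) (b := a k) (c := e)
    linarith
  have hmin2 := hmin' _ hle
  have hPu : P (u : W) = u := hP u
  have hexp : P (a (g * k)) - z = -(1 - τ) • u + (P (a k - τ • (u : W)) + P e) := by
    rw [hek]
    simp only [map_add, map_sub, map_smul, hPu]
    rw [hu]; module
  have hb1 : ‖P (a k - τ • (u : W))‖ ≤ ‖P‖ * (B * τ ^ 2) :=
    (P.le_opNorm _).trans (by gcongr)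
  have hb2 : ‖P e‖ ≤ ‖P‖ * (C * s * (τ * ‖u‖ + B * τ ^ 2)) := by
    refine (P.le_opNorm _).trans ?_
    gcongr
    refine hne'.trans ?_
    gcongr
    have h2 : ‖a k‖ ≤ ‖a k - τ • (u : W)‖ + ‖τ • (u : W)‖ := by
      simpa using norm_add_le (a k - τ • (u : W)) (τ • (u : W))
    rw [norm_smul, Real.norm_of_nonneg τ0.le] at h2
    have : ‖(u : W)‖ = ‖u‖ := rfl
    rw [this] at h2
    linarith
  have hb3 : ‖-(1 - τ) • u‖ = (1 - τ) * ‖u‖ := by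
    rw [norm_smul, norm_neg, Real.norm_of_nonneg (by linarith)]
  have hswap : ‖P w - z‖ = ‖u‖ := by rw [hu, norm_sub_rev]
  rw [hexp, hswap] at hmin2
  have hfin := hmin2.trans ((norm_add_le _ _).trans
    (add_le_add le_rfl ((norm_add_le _ _).trans (add_le_add hb1 hb2))))
  rw [hb3] at hfin
  have e1 : ‖P‖ * (C * s * (τ * ‖u‖ + B * τ ^ 2)) =
    (‖P‖ * C * s) * (τ * ‖u‖) + (‖P‖ * C * s) * (B * τ ^ 2) := by ring
  rw [e1] at hfin
  have e2 : (‖P‖ * C * s) * (τ * ‖u‖) ≤ 1 / 2 * (τ * ‖u‖) := by gcongr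
  have e3 : τ * (τ * ((‖P‖ + ‖P‖ * C * s) * B)) < τ * (‖u‖ / 2) := by gcongr
  nlinarith

/-- With `k = g⁻¹ * h`, `a h = a g + a k` up to `C ‖a g‖ ‖a k‖`. Applying `P` and `‖a k‖ ≤ 2 ‖P (a
k)‖`, the error is absorbed as half of `‖a k‖`, whence the factor 4. This gives both uniqueness and
the Lipschitz bound for the section. -/
theorem exists_norm_inv_mul_le (ha : NearlyAdditive a C r) (P : W →L[ℝ] ha.tangentSpace)
    (hP : ∀ v : ha.tangentSpace, P v = v) :
    ∃ δ > 0, ∀ g h, ‖a g‖ < δ → ‖a h‖ < δ → ‖a (g⁻¹ * h)‖ ≤ 4 * ‖P (a h) - P (a g)‖ := by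
  obtain ⟨δ, hδ, hδ'⟩ := ha.exists_norm_le_proj P hP
  have hC0 := ha.C_nonneg
  have hr := ha.r_pos
  have hPn := norm_nonneg P
  set η := min (min (δ / 4) (r / 4)) (min (1 / (4 * (‖P‖ * C + 1))) (1 / (2 * (C + 1)))) with hη
  have hηpos : 0 < η := by positivity
  have ηδ : 4 * η ≤ δ := by
    have : η ≤ δ / 4 := (min_le_left _ _).trans (min_le_left _ _)
    linarith
  have ηr : 4 * η ≤ r := by
    have : η ≤ r / 4 := (min_le_left _ _).trans (min_le_right _ _)
    linarith
  have ηP : ‖P‖ * C * η ≤ 1 / 4 := by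
    have : η ≤ 1 / (4 * (‖P‖ * C + 1)) := (min_le_right _ _).trans (min_le_left _ _)
    rw [le_div_iff₀ (by positivity)] at this
    nlinarith
  have ηC : C * η ≤ 1 / 2 := by
    have : η ≤ 1 / (2 * (C + 1)) := (min_le_right _ _).trans (min_le_right _ _)
    rw [le_div_iff₀ (by positivity)] at this
    nlinarith
  refine ⟨η, hηpos, fun g h hg hh => ?_⟩
  have hgi := ha.map_inv g (by linarith)
  have hm := ha.map_mul g⁻¹ h (by linarith) (by linarith)
  set k := g⁻¹ * h with hk
  have hk4 : ‖a k‖ < 4 * η := by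
    have h1 : ‖a k‖ ≤ ‖a k - a g⁻¹ - a h‖ + ‖a g⁻¹‖ + ‖a h‖ := by
      calc ‖a k‖ = ‖(a k - a g⁻¹ - a h) + a g⁻¹ + a h‖ := by congr 1; abel
        _ ≤ _ := norm_add₃_le
    have h2 : C * ‖a g⁻¹‖ * ‖a h‖ ≤ C * (2 * η) * ‖a h‖ := by
      gcongr; linarith
    nlinarith [norm_nonneg (a h)]
  have hm2 := ha.map_mul g k (by linarith) (by linarith)
  rw [hk, mul_inv_cancel_left, ← hk] at hm2
  have h2 := hδ' k (by linarith)
  have h3 : P (a k) = (P (a h) - P (a g)) - P (a h - a g - a k) := by simp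
  have h4 : ‖P (a h - a g - a k)‖ ≤ 1 / 4 * ‖a k‖ := by
    calc _ ≤ ‖P‖ * (C * η * ‖a k‖) := (P.le_opNorm _).trans (by
            gcongr; exact hm2.trans (by gcongr))
      _ = (‖P‖ * C * η) * ‖a k‖ := by ring
      _ ≤ _ := by gcongr
  have h5 := norm_sub_le (P (a h) - P (a g)) (P (a h - a g - a k))
  rw [← h3] at h5
  linarith

end NearlyAdditive

/-! ### Smoothness of the section -/

namespace NearlyAdditive

open Filter Asymptotics

variable {G W : Type*} [Group G] [NormedAddCommGroup W] [NormedSpace ℝ W]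
  {a : G → W} {C r : ℝ}

/-- A map whose derivative is a smooth function of its value is smooth. -/
theorem _root_.contDiffOn_of_hasFDerivAt_comp {V : Type*} [NormedAddCommGroup V] [NormedSpace ℝ V]
    {σ : V → W} {s : Set V} {t : Set W} {A : W → V →L[ℝ] W} (hs : IsOpen s)
    (hst : MapsTo σ s t) (hA : ContDiffOn ℝ ∞ A t) (hσ : ∀ z ∈ s, HasFDerivAt σ (A (σ z)) z) :
    ContDiffOn ℝ ∞ σ s := by
  have hd : DifferentiableOn ℝ σ s := fun z hz => (hσ z hz).differentiableAt.differentiableWithinAt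
  have key : ∀ n : ℕ, ContDiffOn ℝ n σ s := by
    intro n
    induction n with
    | zero => exact contDiffOn_zero.2 hd.continuousOn
    | succ n ih =>
      rw [Nat.cast_succ, contDiffOn_succ_iff_fderiv_of_isOpen hs]
      refine ⟨hd, by simp, ?_⟩
      refine ((hA.of_le (by exact_mod_cast le_top)).comp ih hst).congr fun z hz => ?_
      exact (hσ z hz).fderiv
  exact contDiffOn_infty.2 key

variable [FiniteDimensional ℝ W]

/-- Put `k = (γ z)⁻¹ * γ z'`. To first order the increment of the section is `L (a k)`, and `a k` is
tangent, so it is `L (P (a k))`. Projecting gives `z' - z = P L (P (a k)) + o(z' - z)`, and `Q`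
solves for `P (a k)`. -/
theorem hasFDerivAt_section (ha : NearlyAdditive a C r) (P : W →L[ℝ] ha.tangentSpace)
    (hP : ∀ v : ha.tangentSpace, P v = v) {γ : ha.tangentSpace → G} {z : ha.tangentSpace}
    (hγ : ∀ᶠ z' in 𝓝 z, P (a (γ z')) = z')
    (hlip : ∀ᶠ z' in 𝓝 z, ‖a ((γ z)⁻¹ * γ z')‖ ≤ 4 * ‖z' - z‖) {L : W →L[ℝ] W}
    (hL : (fun k => a (γ z * k) - a (γ z) - L (a k)) =o[comap a (𝓝 0)] a)
    {Q : ha.tangentSpace →L[ℝ] ha.tangentSpace}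
    (hQ : Q ∘L (P ∘L L ∘L ha.tangentSpace.subtypeL) = ContinuousLinearMap.id ℝ _) :
    HasFDerivAt (fun z => a (γ z)) ((L ∘L ha.tangentSpace.subtypeL) ∘L Q) z := by
  set k : ha.tangentSpace → G := fun z' => (γ z)⁻¹ * γ z' with hk
  have hO : (fun z' => a (k z')) =O[𝓝 z] fun z' => z' - z := IsBigO.of_bound 4 hlip
  have hz0 : Tendsto (fun z' => z' - z) (𝓝 z) (𝓝 0) :=
    Continuous.tendsto' (by fun_prop) _ _ (by simp)
  have hk0 : Tendsto (fun z' => a (k z')) (𝓝 z) (𝓝 0) := hO.trans_tendsto hz0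
  have hkc : Tendsto k (𝓝 z) (comap a (𝓝 0)) := tendsto_comap_iff.2 hk0
  have hR1 : (fun z' => a (γ z') - a (γ z) - L (a (k z'))) =o[𝓝 z] fun z' => z' - z := by
    have := (hL.comp_tendsto hkc).trans_isBigO hO
    refine this.congr_left fun z' => ?_
    simp [hk]
  have hR2 : (fun z' => a (k z') - P (a (k z'))) =o[𝓝 z] fun z' => z' - z := by
    refine IsLittleO.trans_isBigO ?_ hO
    refine IsLittleO.of_bound fun ε hε => ?_
    obtain ⟨δ, hδ, h⟩ := ha.norm_sub_proj_le P hP hε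
    have : ∀ᶠ z' in 𝓝 z, ‖a (k z')‖ < δ := by
      have := hk0.norm
      rw [norm_zero] at this
      exact this.eventually (gt_mem_nhds hδ)
    exact this.mono fun z' hz' => h _ hz'
  set R : ha.tangentSpace → W := fun z' =>
    L (a (k z') - P (a (k z'))) + (a (γ z') - a (γ z) - L (a (k z'))) with hR
  have hRo : R =o[𝓝 z] fun z' => z' - z :=
    ((L.isBigO_comp _ _).trans_isLittleO hR2).add hR1
  have hRo' : (fun z' => R z' - L (Q (P (R z')))) =o[𝓝 z] fun z' => z' - z := by
    refine hRo.sub ?_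
    refine IsBigO.trans_isLittleO ?_ hRo
    exact (L ∘L ha.tangentSpace.subtypeL ∘L Q ∘L P).isBigO_comp R _
  rw [hasFDerivAt_iff_isLittleO]
  refine hRo'.congr' ?_ EventuallyEq.rfl
  filter_upwards [hγ] with z' hz'
  have hz := hγ.self_of_nhds
  have e1 : a (γ z') - a (γ z) = L (P (a (k z'))) + R z' := by
    rw [hR]; simp
  have e2 : z' - z = P (L (P (a (k z')))) + P (R z') := by
    rw [← map_add, ← e1, map_sub, hz', hz]
  have e3 : Q (z' - z) = P (a (k z')) + Q (P (R z')) := by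
    rw [e2, map_add]
    congr 1
    exact DFunLike.congr_fun hQ (P (a (k z')))
  simp only [ContinuousLinearMap.comp_apply, Submodule.subtypeL_apply]
  rw [e1, e3]
  simp

/-- The image of a nearly additive map is, near the origin, the image of a smooth section of a
linear projection. -/
theorem exists_smooth_section (ha : NearlyAdditive a C r) {L : W → W →L[ℝ] W}
    (hLs : ∀ᶠ w in 𝓝 0, ContDiffAt ℝ ∞ L w) (hL0 : L 0 = ContinuousLinearMap.id ℝ W)
    (hL : ∀ g, ‖a g‖ < r → (fun k => a (g * k) - a g - L (a g) (a k)) =o[comap a (𝓝 0)] a) :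
    ∃ k ≤ Module.finrank ℝ W, ∃ (P : W →L[ℝ] EuclideanSpace ℝ (Fin k))
      (B : Set (EuclideanSpace ℝ (Fin k))) (δ : ℝ) (γ : EuclideanSpace ℝ (Fin k) → G),
      IsOpen B ∧ 0 ∈ B ∧ 0 < δ ∧ (∀ z ∈ B, P (a (γ z)) = z ∧ ‖a (γ z)‖ < δ) ∧
      ContDiffOn ℝ ∞ (fun z => a (γ z)) B ∧
      ∀ g, ‖a g‖ < δ → P (a g) ∈ B → a (g⁻¹ * γ (P (a g))) = 0 := by
  obtain ⟨P, hP⟩ := Submodule.ClosedComplemented.of_finiteDimensional ha.tangentSpace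
  obtain ⟨ρ, hρ, hsurj⟩ := ha.exists_proj_eq P hP
  obtain ⟨δ, hδ, hinj⟩ := ha.exists_norm_inv_mul_le P hP
  set ι := ha.tangentSpace.subtypeL with hι
  set q : W → (ha.tangentSpace →L[ℝ] ha.tangentSpace) := fun w => P ∘L L w ∘L ι with hq
  have hqs : ∀ w, ContDiffAt ℝ ∞ L w → ContDiffAt ℝ ∞ q w := fun w hw =>
    contDiffAt_const.clm_comp (hw.clm_comp contDiffAt_const)
  have hq0 : q 0 = 1 := by
    ext v
    simp [hq, hL0, hι, hP]
  have hunit : ∀ᶠ w in 𝓝 (0 : W), IsUnit (q w) := by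
    refine (hqs 0 hLs.self_of_nhds).continuousAt.eventually ?_
    rw [hq0]
    exact (Units.isOpen (R := ha.tangentSpace →L[ℝ] ha.tangentSpace)).mem_nhds isUnit_one
  -- The derivative of the section at a point with value `w`. It is smooth near `0` since `q 0 = 1`
  -- and units are open.
  set A : W → (ha.tangentSpace →L[ℝ] W) := fun w => (L w ∘L ι) ∘L Ring.inverse (q w) with hA
  have hAs : ∀ᶠ w in 𝓝 (0 : W), ContDiffAt ℝ ∞ A w := by
    filter_upwards [hLs, hunit] with w hw hu
    refine (hw.clm_comp contDiffAt_const).clm_comp ?_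
    have : ContDiffAt ℝ ∞ Ring.inverse (q w) := by
      obtain ⟨u, hu⟩ := hu
      rw [← hu]
      exact contDiffAt_ringInverse (R := ha.tangentSpace →L[ℝ] ha.tangentSpace) ℝ u
    exact this.comp w (hqs w hw)
  obtain ⟨η, hη, hηball⟩ := Metric.eventually_nhds_iff_ball.1 (hunit.and hAs)
  set ρ' := min ρ (min (δ / 4) (min (η / 4) (r / 4))) with hρ'
  have hρ'pos : 0 < ρ' := by have := ha.r_pos; positivity
  have h1 : ρ' ≤ ρ := min_le_left _ _
  have h2 : ρ' ≤ δ / 4 := (min_le_right _ _).trans (min_le_left _ _)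
  have h3 : ρ' ≤ η / 4 := (min_le_right _ _).trans ((min_le_right _ _).trans (min_le_left _ _))
  have h4 : ρ' ≤ r / 4 := (min_le_right _ _).trans ((min_le_right _ _).trans (min_le_right _ _))
  -- The section is total, with the irrelevant value `1` outside the ball. The quarters in `ρ'`
  -- compensate the factor 4.
  have hγex : ∀ z : ha.tangentSpace, ∃ g, ‖z‖ < ρ' → ‖a g‖ ≤ 4 * ‖z‖ ∧ P (a g) = z := by
    intro z
    by_cases hz : ‖z‖ < ρ'
    · obtain ⟨g, hg⟩ := hsurj z (hz.trans_le h1)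
      exact ⟨g, fun _ => hg⟩
    · exact ⟨1, fun h => absurd h hz⟩
  choose γ hγ using hγex
  have hder : ∀ z ∈ Metric.ball (0 : ha.tangentSpace) ρ',
      HasFDerivAt (fun z => a (γ z)) (A (a (γ z))) z := by
    intro z hz
    have hz' : ‖z‖ < ρ' := by simpa using hz
    have hγz := hγ z hz'
    have hev : ∀ᶠ z' in 𝓝 z, ‖z'‖ < ρ' := by
      filter_upwards [Metric.isOpen_ball.mem_nhds hz] with z' h'
      simpa using h'
    refine ha.hasFDerivAt_section P hP (hev.mono fun z' h' => (hγ z' h').2) ?_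
      (hL _ (by linarith)) ?_
    · filter_upwards [hev] with z' h'
      have := hinj (γ z) (γ z') (by linarith) (by linarith [(hγ z' h').1])
      rwa [hγz.2, (hγ z' h').2] at this
    · exact Ring.inverse_mul_cancel _ (hηball (a (γ z)) (by simp; linarith)).1
  have hcd : ContDiffOn ℝ ∞ (fun z => a (γ z)) (Metric.ball 0 ρ') := by
    refine contDiffOn_of_hasFDerivAt_comp (t := Metric.ball 0 η) Metric.isOpen_ball ?_
      (fun w hw => (hηball w hw).2.contDiffWithinAt) hder
    intro z hz
    have hz' : ‖z‖ < ρ' := by simpa using hz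
    have := (hγ z hz').1
    simp only [Metric.mem_ball, dist_zero_right]
    linarith
  let e : ha.tangentSpace ≃L[ℝ] EuclideanSpace ℝ (Fin (Module.finrank ℝ ha.tangentSpace)) :=
    ContinuousLinearEquiv.ofFinrankEq (by simp)
  refine ⟨_, Submodule.finrank_le _, e.toContinuousLinearMap ∘L P, e.symm ⁻¹' Metric.ball 0 ρ', δ,
    fun z => γ (e.symm z), Metric.isOpen_ball.preimage e.symm.continuous, by simpa using hρ'pos,
    hδ, fun z hz => ?_, ?_, fun g hg hgB => ?_⟩
  · have hz' : ‖e.symm z‖ < ρ' := by simpa using hz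
    obtain ⟨i1, i2⟩ := hγ _ hz'
    exact ⟨by simp [i2], by linarith⟩
  · exact hcd.comp e.symm.contDiff.contDiffOn fun z hz => hz
  · have hz' : ‖P (a g)‖ < ρ' := by simpa using hgB
    obtain ⟨i1, i2⟩ := hγ _ hz'
    have := hinj g (γ (P (a g))) hg (by linarith)
    rw [i2, sub_self, norm_zero, mul_zero] at this
    simpa using this

end NearlyAdditive

/-! ### Rigid transformation groups -/

/-- A group of homeomorphisms of an open set whose elements `g` are, locally, given by a smooth
formula `g y = E (x, g x, y)`. -/
structure HasLocalFormula {W : Type*} [NormedAddCommGroup W] [NormedSpace ℝ W] {U : Opens W}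
    (H : Subgroup (U ≃ₜ U)) : Prop where
  exists_formula : ∀ q b : U, ∃ E : W × W × W → W,
    (∀ᶠ z in 𝓝 ((q : W), (b : W), (q : W)), ContDiffAt ℝ ∞ E z) ∧ E (q, b, q) = b ∧
    ∀ᶠ z : U × U × U in 𝓝 (q, b, q), ∀ g ∈ H, g z.1 = z.2.1 →
      (g z.2.2 : W) = E (z.1, z.2.1, z.2.2)

/-- A group of homeomorphisms of an open set is rigid if its elements are given by a local smooth
formula, and if it is closed under pointwise convergence of the transformations together with
their inverses. -/
structure RigidGroup {W : Type*} [NormedAddCommGroup W] [NormedSpace ℝ W] {U : Opens W}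
    (H : Subgroup (U ≃ₜ U)) : Prop extends HasLocalFormula H where
  closed : ∀ (l : Filter H) [l.NeBot] (Φ Ψ : U → U),
    (∀ q, Filter.Tendsto (fun g : H => g.1 q) l (𝓝 (Φ q))) →
    (∀ q, Filter.Tendsto (fun g : H => g.1.symm q) l (𝓝 (Ψ q))) → ∃ g : H, ∀ q, g.1 q = Φ q

/-! ### Consequences of the local formula -/

namespace HasLocalFormula

open Filter

variable {W : Type*} [NormedAddCommGroup W] [NormedSpace ℝ W] {U : Opens W}
  {H : Subgroup (U ≃ₜ U)}

/-- A form of the formula with values in `U` and uniform over boxes; where `E` leaves `U` the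
default value `b` is used. -/
theorem exists_local (hH : HasLocalFormula H) (q b : U) :
    ∃ (N M : Set U) (E : U × U × U → U), IsOpen N ∧ q ∈ N ∧ IsOpen M ∧ b ∈ M ∧ E (q, b, q) = b ∧
      (∀ x ∈ N, ∀ m ∈ M, ∀ y ∈ N, ContinuousAt E (x, m, y)) ∧
      ∀ g : H, ∀ x ∈ N, g.1 x ∈ M → ∀ y ∈ N, g.1 y = E (x, g.1 x, y) := by
  classical
  obtain ⟨E, hE, hEb, hform⟩ := hH.exists_formula q b
  have hc : Continuous fun z : U × U × U => ((z.1 : W), (z.2.1 : W), (z.2.2 : W)) := by fun_prop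
  have h1 : ∀ᶠ z : U × U × U in 𝓝 (q, b, q), ContDiffAt ℝ ∞ E (z.1, z.2.1, z.2.2) :=
    hc.continuousAt.eventually hE
  have h2 : ∀ᶠ z : U × U × U in 𝓝 (q, b, q), E (z.1, z.2.1, z.2.2) ∈ U := by
    have : ContinuousAt (fun z : U × U × U => E (z.1, z.2.1, z.2.2)) (q, b, q) :=
      ContinuousAt.comp (g := E) h1.self_of_nhds.continuousAt hc.continuousAt
    refine this.eventually (U.isOpen.mem_nhds ?_)
    simp only [hEb]
    exact b.2
  obtain ⟨S, hS, hSo, hSm⟩ := eventually_nhds_iff.1 (h1.and (h2.and hform))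
  obtain ⟨N₁, T, hN₁, hqN₁, hT, hT'⟩ := mem_nhds_prod_iff'.1 (hSo.mem_nhds hSm)
  obtain ⟨hbT, hT'⟩ := hT'
  obtain ⟨M, N₂, hM, hbM, hN₂, hqN₂, hMN⟩ := mem_nhds_prod_iff'.1 (hT.mem_nhds hbT)
  have hbox : ∀ x ∈ N₁ ∩ N₂, ∀ m ∈ M, ∀ y ∈ N₁ ∩ N₂, (x, m, y) ∈ S := fun x hx m hm y hy =>
    hT' ⟨hx.1, hMN ⟨hm, hy.2⟩⟩
  refine ⟨N₁ ∩ N₂, M, fun z => if h : E (z.1, z.2.1, z.2.2) ∈ U then ⟨_, h⟩ else b,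
    hN₁.inter hN₂, ⟨hqN₁, hqN₂⟩, hM, hbM, ?_,
    fun x hx m hm y hy => ?_, fun g x hx hm y hy => ?_⟩
  · ext
    simp [hEb]
  · rw [IsInducing.subtypeVal.continuousAt_iff]
    have hz := hbox x hx m hm y hy
    have : ContinuousAt (fun z : U × U × U => E (z.1, z.2.1, z.2.2)) (x, m, y) :=
      ContinuousAt.comp (g := E) (hS _ hz).1.continuousAt hc.continuousAt
    refine this.congr ?_
    filter_upwards [hSo.mem_nhds hz] with z hz
    simp [(hS z hz).2.1]
  · have hz := hS _ (hbox x hx _ hm y hy)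
    have h3 := hz.2.2 g.1 g.2 rfl
    ext
    simp only [h3, dif_pos hz.2.1]

/-- Convergence at `q` is automatically continuous convergence there, since `E` is continuous in all
its arguments and `E (q, b, q) = b`. -/
theorem tendsto_apply_of_tendsto (hH : HasLocalFormula H) {ι : Type*} {l : Filter ι} {Φ : ι → H}
    {q b : U} {x : ι → U} (h : Tendsto (fun i => (Φ i).1 q) l (𝓝 b)) (hx : Tendsto x l (𝓝 q)) :
    Tendsto (fun i => (Φ i).1 (x i)) l (𝓝 b) := by
  obtain ⟨N, M, E, hN, hqN, hM, hbM, hEb, hcont, hE⟩ := hH.exists_local q b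
  have h2 : Tendsto (fun i => E (q, (Φ i).1 q, x i)) l (𝓝 (E (q, b, q))) :=
    (hcont q hqN _ hbM q hqN).tendsto.comp
      (tendsto_const_nhds.prodMk_nhds (h.prodMk_nhds hx))
  rw [hEb] at h2
  refine h2.congr' ?_
  filter_upwards [h.eventually (hM.mem_nhds hbM), hx.eventually (hN.mem_nhds hqN)] with i hi hi'
  exact (hE _ q hqN hi _ hi').symm

theorem contMDiff_apply (hH : HasLocalFormula H) (g : H) :
    ContMDiff 𝓘(ℝ, W) 𝓘(ℝ, W) ∞ g.1 := by
  intro q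
  rw [← ContMDiffAt.subtypeVal_comp_iff]
  obtain ⟨E, hE, -, hform⟩ := hH.exists_formula q (g.1 q)
  have h1 : ContMDiffAt 𝓘(ℝ, W) 𝓘(ℝ, W) ∞ (fun y : W => E (q, g.1 q, y)) q :=
    (hE.self_of_nhds.comp (f := fun y : W => ((q : W), (g.1 q : W), y)) (q : W)
      (by fun_prop)).contMDiffAt
  refine (contMDiffAt_subtype_iff.2 h1).congr_of_eventuallyEq ?_
  have hc : Tendsto (fun y : U => (q, g.1 q, y)) (𝓝 q) (𝓝 (q, g.1 q, q)) :=
    Continuous.tendsto' (by fun_prop) _ _ rfl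
  filter_upwards [hc.eventually hform] with y hy
  exact hy g.1 g.2 rfl

end HasLocalFormula

/-! ### Orbits and the topology of a rigid group -/

namespace RigidGroup

set_option linter.unusedSectionVars false

open Filter

variable {W : Type*} [NormedAddCommGroup W] [NormedSpace ℝ W] {U : Opens W}
  {H : Subgroup (U ≃ₜ U)}

variable [PreconnectedSpace U]

/-- The coincidence set is closed, and open by the local formula. -/
theorem eq_of_apply_eq (hH : RigidGroup H) {g h : H} {o : U} (ho : g.1 o = h.1 o) : g = h := by
  have hclopen : IsClopen {q : U | g.1 q = h.1 q} := by
    refine ⟨isClosed_eq g.1.continuous h.1.continuous, ?_⟩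
    rw [isOpen_iff_mem_nhds]
    intro q hq
    obtain ⟨N, M, E, hN, hqN, hM, hbM, -, -, hE⟩ := hH.exists_local q (g.1 q)
    filter_upwards [hN.mem_nhds hqN] with y hy
    have hq' : g.1 q = h.1 q := hq
    show g.1 y = h.1 y
    rw [hE g q hqN hbM y hy, hE h q hqN (hq' ▸ hbM) y hy, hq']
  have := hclopen.eq_univ ⟨o, ho⟩
  ext q
  have hq : q ∈ {q : U | g.1 q = h.1 q} := this ▸ mem_univ q
  exact congrArg Subtype.val hq

variable {ι : Type*} {l : Filter ι} [l.NeBot] {Φ : ι → H}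

/-- The formula for the inverse, which sends `Φ i y` to `y`, gives its value at `b` as `E (Φ i y, y,
b)`, which tends to `E (b, y, b) = y`. -/
theorem tendsto_symm_apply (hH : RigidGroup H) {y b : U}
    (h : Tendsto (fun i => (Φ i).1 y) l (𝓝 b)) :
    Tendsto (fun i => (Φ i).1.symm b) l (𝓝 y) := by
  obtain ⟨N, M, E, hN, hbN, hM, hyM, hEy, hcont, hE⟩ := hH.exists_local b y
  have hev := h.eventually (hN.mem_nhds hbN)
  have key : ∀ i, (Φ i).1 y ∈ N → ∀ w ∈ N, (Φ i).1.symm w = E ((Φ i).1 y, y, w) := by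
    intro i hi w hw
    have := hE (Φ i)⁻¹ ((Φ i).1 y) hi
    have e : ((Φ i)⁻¹).1 ((Φ i).1 y) = y := (Φ i).1.symm_apply_apply y
    rw [e] at this
    exact this hyM w hw
  have h4 : Tendsto (fun i => E ((Φ i).1 y, y, b)) l (𝓝 (E (b, y, b))) :=
    (hcont b hbN y hyM b hbN).tendsto.comp
      (h.prodMk_nhds (tendsto_const_nhds.prodMk_nhds tendsto_const_nhds))
  rw [hEy] at h4
  refine h4.congr' ?_
  filter_upwards [hev] with i hi
  exact (key i hi b hbN).symm

/-- The set of points of convergence is open by the local formula. For closedness at `q`, the values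
near `q` are not known to stay near any given point, so the family is first translated back by one
of its members. -/
theorem exists_tendsto_apply (hH : RigidGroup H) {o b : U}
    (h : Tendsto (fun i => (Φ i).1 o) l (𝓝 b)) (q : U) :
    ∃ c, Tendsto (fun i => (Φ i).1 q) l (𝓝 c) := by
  have hclopen : IsClopen {q : U | ∃ c, Tendsto (fun i => (Φ i).1 q) l (𝓝 c)} := by
    constructor
    · rw [← closure_subset_iff_isClosed]
      intro q hq
      obtain ⟨N, M, E, hN, hqN, hM, hqM, -, hcont, hE⟩ := hH.exists_local q q
      obtain ⟨y, ⟨hyN, hyM⟩, b, hb⟩ := mem_closure_iff.1 hq (N ∩ M) (hN.inter hM) ⟨hqN, hqM⟩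
      -- For this `j` the maps `(Φ j)⁻¹ * Φ i` eventually send `y` into `M`, so the formula centred
      -- at `(q, q)` applies to them.
      obtain ⟨j, hj⟩ := ((hH.tendsto_symm_apply hb).eventually (hM.mem_nhds hyM)).exists
      have h1 : Tendsto (fun i => ((Φ j)⁻¹ * Φ i).1 y) l (𝓝 ((Φ j).1.symm b)) :=
        ((Φ j).1.symm.continuous.tendsto b).comp hb
      have h2 : Tendsto (fun i => E (y, ((Φ j)⁻¹ * Φ i).1 y, q)) l
          (𝓝 (E (y, (Φ j).1.symm b, q))) :=
        (hcont y hyN _ hj q hqN).tendsto.comp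
          (tendsto_const_nhds.prodMk_nhds (h1.prodMk_nhds tendsto_const_nhds))
      refine ⟨_, (((Φ j).1.continuous.tendsto _).comp h2).congr' ?_⟩
      filter_upwards [h1.eventually (hM.mem_nhds hj)] with i hi
      have := hE _ y hyN hi q hqN
      simp only [Function.comp]
      rw [← this]
      exact (Φ j).1.apply_symm_apply _
    · rw [isOpen_iff_mem_nhds]
      rintro q ⟨b, hb⟩
      obtain ⟨N, M, E, hN, hqN, hM, hbM, -, hcont, hE⟩ := hH.exists_local q b
      filter_upwards [hN.mem_nhds hqN] with y hy
      have h2 : Tendsto (fun i => E (q, (Φ i).1 q, y)) l (𝓝 (E (q, b, y))) :=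
        (hcont q hqN _ hbM y hy).tendsto.comp
          (tendsto_const_nhds.prodMk_nhds (hb.prodMk_nhds tendsto_const_nhds))
      refine ⟨_, h2.congr' ?_⟩
      filter_upwards [hb.eventually (hM.mem_nhds hbM)] with i hi
      exact (hE _ q hqN hi y hy).symm
  have := hclopen.eq_univ ⟨o, b, h⟩
  exact (this ▸ mem_univ q : q ∈ {q : U | ∃ c, Tendsto (fun i => (Φ i).1 q) l (𝓝 c)})

theorem exists_forall_tendsto (hH : RigidGroup H) {o b : U}
    (h : Tendsto (fun i => (Φ i).1 o) l (𝓝 b)) :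
    ∃ g : H, g.1 o = b ∧ ∀ q, Tendsto (fun i => (Φ i).1 q) l (𝓝 (g.1 q)) := by
  choose F hF using hH.exists_tendsto_apply h
  choose F' hF' using hH.exists_tendsto_apply (Φ := fun i => (Φ i)⁻¹) (hH.tendsto_symm_apply h)
  obtain ⟨g, hg⟩ := hH.closed (l.map Φ) F F' (fun q => tendsto_map'_iff.2 (hF q))
    (fun q => tendsto_map'_iff.2 (hF' q))
  refine ⟨g, ?_, fun q => by rw [hg]; exact hF q⟩
  rw [hg]
  exact tendsto_nhds_unique (hF o) h

theorem isClosed_range_apply (hH : RigidGroup H) (o : U) :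
    IsClosed (range fun g : H => g.1 o) := by
  rw [← closure_subset_iff_isClosed]
  intro b hb
  have : (comap (fun g : H => g.1 o) (𝓝 b)).NeBot := by
    rw [comap_neBot_iff_frequently]
    exact mem_closure_iff_frequently.1 hb
  obtain ⟨g, hg, -⟩ := hH.exists_forall_tendsto (Φ := id)
    (tendsto_comap : Tendsto (fun g : H => g.1 o) (comap _ (𝓝 b)) _)
  exact ⟨g, hg⟩

theorem continuous_action_induced (hH : RigidGroup H) (o : U) :
    letI : TopologicalSpace H := .induced (fun g => g.1 o) inferInstance
    Continuous fun z : H × U => z.1.1 z.2 := by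
  let _ : TopologicalSpace H := .induced (fun g => g.1 o) inferInstance
  rw [continuous_iff_continuousAt]
  rintro ⟨g, q⟩
  have h1 : Tendsto (fun z : H × U => z.1.1 o) (𝓝 (g, q)) (𝓝 (g.1 o)) :=
    (continuous_induced_dom.comp continuous_fst).tendsto (g, q)
  obtain ⟨g', hg', h⟩ := hH.exists_forall_tendsto (Φ := Prod.fst) h1
  obtain rfl := hH.eq_of_apply_eq hg'
  exact hH.tendsto_apply_of_tendsto (Φ := Prod.fst) (h q) (continuous_snd.tendsto (g', q))

/-- Evaluation at `o` is continuous for the compact-open topology. Conversely, joint continuity of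
the action in the topology induced from the orbit gives, by currying, continuity into `C(U, U)`. -/
theorem isEmbedding_apply [TopologicalSpace H] (hH : RigidGroup H)
    (hτ : IsInducing fun g : H => (⟨g.1, g.1.continuous⟩ : C(U, U))) (o : U) :
    IsEmbedding fun g : H => g.1 o := by
  rename_i τ
  refine ⟨⟨le_antisymm ?_ ?_⟩, fun g h => hH.eq_of_apply_eq⟩
  · rw [← continuous_iff_le_induced]
    have := hτ.continuous
    exact (continuous_eval_const (F := C(U, U)) o).comp this
  · rw [hτ.eq_induced]
    let τ' : TopologicalSpace H := .induced (fun g => g.1 o) inferInstance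
    have h1 := ContinuousMap.continuous_of_continuous_uncurry
      (fun g : H => (⟨g.1, g.1.continuous⟩ : C(U, U))) (hH.continuous_action_induced o)
    exact continuous_iff_le_induced.1 h1

end RigidGroup

/-! ### The displacement of a base point is nearly additive -/

namespace RigidGroup

set_option linter.unusedSectionVars false

open Filter Asymptotics

variable {W : Type*} [NormedAddCommGroup W] [NormedSpace ℝ W] {U : Opens W}
  {H : Subgroup (U ≃ₜ U)}

/-- The displacement of the point `o`. -/
def displacement (H : Subgroup (U ≃ₜ U)) (o : U) (g : H) : W := (g.1 o : W) - o

theorem displacement_add (o : U) (g : H) : displacement H o g + o = g.1 o := by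
  simp [displacement]

/-- Fixing the first argument of the formula at `o` leaves a smooth local product on the ambient
space, even off the orbit. -/
theorem exists_local_product (hH : RigidGroup H) (o : U) :
    ∃ (m : W × W → W) (r : ℝ), 0 < r ∧ Metric.closedBall (o : W) r ⊆ U ∧
      (∀ x ∈ Metric.ball (o : W) r, ∀ y ∈ Metric.ball (o : W) r, ContDiffAt ℝ ∞ m (x, y)) ∧
      ∀ g : H, (g.1 o : W) ∈ Metric.ball (o : W) r → ∀ y : U, (y : W) ∈ Metric.ball (o : W) r →
        (g.1 y : W) = m (g.1 o, y) := by
  obtain ⟨E, hE, -, hform⟩ := hH.exists_formula o o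
  have h1 : ∀ᶠ z : W × W in 𝓝 ((o : W), (o : W)), ContDiffAt ℝ ∞ E (o, z.1, z.2) := by
    have : Continuous fun z : W × W => ((o : W), z.1, z.2) := by fun_prop
    exact this.continuousAt.eventually hE
  have h2 : ∀ᶠ z : U × U in 𝓝 (o, o), ∀ g ∈ H, g o = z.1 → (g z.2 : W) = E (o, z.1, z.2) := by
    have : Continuous fun z : U × U => (o, z.1, z.2) := by fun_prop
    exact (this.tendsto (o, o)).eventually hform
  have h3 : ∀ᶠ z : W × W in 𝓝 ((o : W), (o : W)), ∀ (z1 : z.1 ∈ U) (z2 : z.2 ∈ U), ∀ g ∈ H,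
      g o = ⟨z.1, z1⟩ → (g ⟨z.2, z2⟩ : W) = E (o, z.1, z.2) := by
    have hemb : IsOpenEmbedding (Prod.map ((↑) : U → W) ((↑) : U → W)) :=
      U.isOpenEmbedding'.prodMap U.isOpenEmbedding'
    have := hemb.map_nhds_eq (o, o)
    simp only [Prod.map_apply] at this
    rw [← this, eventually_map]
    filter_upwards [h2] with z hz z1 z2 g hg he
    exact hz g hg he
  have h4 : ∀ᶠ x in 𝓝 (o : W), x ∈ U := U.isOpen.mem_nhds o.2
  obtain ⟨r₁, hr₁, hb₁⟩ := Metric.eventually_nhds_iff_ball.1 (h1.and h3)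
  obtain ⟨r₂, hr₂, hb₂⟩ := Metric.eventually_nhds_iff_ball.1 h4
  have hmem : ∀ x ∈ Metric.ball (o : W) (min r₁ (r₂ / 2)), ∀ y ∈ Metric.ball (o : W)
      (min r₁ (r₂ / 2)), (x, y) ∈ Metric.ball ((o : W), (o : W)) r₁ := by
    intro x hx y hy
    rw [← ball_prod_same]
    exact ⟨Metric.ball_subset_ball (min_le_left _ _) hx,
      Metric.ball_subset_ball (min_le_left _ _) hy⟩
  refine ⟨fun z => E (o, z.1, z.2), min r₁ (r₂ / 2), by positivity, fun x hx => ?_,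
    fun x hx y hy => ?_, fun g hg y hy => ?_⟩
  · refine hb₂ x (Metric.closedBall_subset_ball ?_ hx)
    have := min_le_right r₁ (r₂ / 2)
    linarith
  · have := (hb₁ _ (hmem x hx y hy)).1
    exact this.comp (f := fun z : W × W => ((o : W), z.1, z.2)) (x, y) (by fun_prop)
  · exact (hb₁ _ (hmem _ hg _ hy)).2 (g.1 o).2 y.2 g.1 g.2 rfl

/-- The partial derivative of `m` in the second variable. -/
noncomputable def sndDeriv (m : W × W → W) (z : W × W) : W →L[ℝ] W :=
  (fderiv ℝ m z).comp (ContinuousLinearMap.inr ℝ W W)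

theorem hasFDerivAt_snd {m : W × W → W} {x y : W} (h : ContDiffAt ℝ ∞ m (x, y)) :
    HasFDerivAt (fun y => m (x, y)) (sndDeriv m (x, y)) y :=
  HasFDerivAt.comp (g := m) (f := fun y => (x, y)) y
    (h.differentiableAt (by simp)).hasFDerivAt (hasFDerivAt_prodMk_right x y)

theorem contDiffAt_sndDeriv {m : W × W → W} {z : W × W} (h : ContDiffAt ℝ ∞ m z) :
    ContDiffAt ℝ ∞ (sndDeriv m) z :=
  (h.fderiv_right (m := ∞) (by simp)).clm_comp contDiffAt_const

section

variable {o : U} {m : W × W → W} {r : ℝ} (hr : 0 < r) (hrU : Metric.closedBall (o : W) r ⊆ U)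
  (hm : ∀ x ∈ Metric.ball (o : W) r, ∀ y ∈ Metric.ball (o : W) r, ContDiffAt ℝ ∞ m (x, y))
  (hform : ∀ g : H, (g.1 o : W) ∈ Metric.ball (o : W) r → ∀ y : U,
    (y : W) ∈ Metric.ball (o : W) r → (g.1 y : W) = m (g.1 o, y))
include hr hrU hm hform

theorem sndDeriv_self {y : W} (hy : y ∈ Metric.ball (o : W) r) :
    sndDeriv m (o, y) = ContinuousLinearMap.id ℝ W := by
  have ho : (o : W) ∈ Metric.ball (o : W) r := Metric.mem_ball_self hr
  refine (hasFDerivAt_snd (hm o ho y hy)).unique ?_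
  refine (hasFDerivAt_id y).congr_of_eventuallyEq ?_
  filter_upwards [Metric.isOpen_ball.mem_nhds hy] with w hw
  exact (hform 1 ho ⟨w, hrU (Metric.ball_subset_closedBall hw)⟩ hw).symm

/-- Mean value inequality for `w ↦ m (x, w) - w` with `x = g o`: its derivative is the difference of
`sndDeriv m` at `(x, w)` and at `(o, w)`, which is Lipschitz in `x`. For `y = h o` this is near
additivity. -/
theorem exists_norm_apply_sub_le : ∃ C ≥ 0, ∃ s > 0, s ≤ r ∧ ∀ g : H,
    ‖displacement H o g‖ < s → ∀ y : U, ‖(y : W) - o‖ < s →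
      ‖(g.1 y : W) - y - displacement H o g‖ ≤ C * ‖displacement H o g‖ * ‖(y : W) - o‖ := by
  have ho : (o : W) ∈ Metric.ball (o : W) r := Metric.mem_ball_self hr
  obtain ⟨K, t, ht, hK⟩ :=
    ((contDiffAt_sndDeriv (hm o ho o ho)).of_le (m := 1) (by simp)).exists_lipschitzOnWith
  obtain ⟨s₀, hs₀, hst⟩ := Metric.mem_nhds_iff.1 ht
  rw [← ball_prod_same] at hst
  refine ⟨K, K.2, min r s₀, by positivity, min_le_left _ _, fun g hg y hy => ?_⟩
  set x : W := (g.1 o : W) with hx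
  have hgx : displacement H o g = x - o := rfl
  have hxb : x ∈ Metric.ball (o : W) (min r s₀) := by rwa [mem_ball_iff_norm]
  have hyb : (y : W) ∈ Metric.ball (o : W) (min r s₀) := by rwa [mem_ball_iff_norm]
  have hob : (o : W) ∈ Metric.ball (o : W) (min r s₀) := Metric.mem_ball_self (by positivity)
  have i1 : Metric.ball (o : W) (min r s₀) ⊆ Metric.ball (o : W) r :=
    Metric.ball_subset_ball (min_le_left _ _)
  have i2 : Metric.ball (o : W) (min r s₀) ⊆ Metric.ball (o : W) s₀ :=
    Metric.ball_subset_ball (min_le_right _ _)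
  have key := (convex_ball (o : W) (min r s₀)).norm_image_sub_le_of_norm_hasFDerivWithin_le
    (f := fun w => m (x, w) - w) (C := K * ‖x - o‖)
    (f' := fun w => sndDeriv m (x, w) - ContinuousLinearMap.id ℝ W)
    (fun w hw => ((hasFDerivAt_snd (hm x (i1 hxb) w (i1 hw))).sub
      (hasFDerivAt_id w)).hasFDerivWithinAt) (fun w hw => ?_) hob hyb
  · rw [← hform g (i1 hxb) y (i1 hyb), ← hform g (i1 hxb) o ho] at key
    rw [hgx]
    exact key
  · rw [← sndDeriv_self hr hrU hm hform (i1 hw), ← dist_eq_norm]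
    have := hK.dist_le_mul (x, w) (hst ⟨i2 hxb, i2 hw⟩) ((o : W), w) (hst ⟨i2 hob, i2 hw⟩)
    rwa [dist_prod_same_right, dist_eq_norm x] at this

end

variable [FiniteDimensional ℝ W] [PreconnectedSpace U]

theorem isCompact_range_displacement (hH : RigidGroup H) (o : U) {s : ℝ}
    (hs : Metric.closedBall (o : W) s ⊆ U) :
    IsCompact (range (displacement H o) ∩ Metric.closedBall 0 s) := by
  have h1 : IsCompact (((↑) : U → W) ⁻¹' Metric.closedBall (o : W) s) := by
    refine IsInducing.subtypeVal.isCompact_preimage' (isCompact_closedBall _ _) ?_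
    rwa [Subtype.range_coe]
  have h2 := (h1.inter_left (hH.isClosed_range_apply o)).image
    (f := fun x : U => (x : W) - o) (by fun_prop)
  convert h2 using 1
  ext w
  constructor
  · rintro ⟨⟨g, rfl⟩, hg⟩
    exact ⟨g.1 o, ⟨⟨g, rfl⟩, by simpa [Subtype.dist_eq, dist_eq_norm, displacement] using hg⟩, rfl⟩
  · rintro ⟨x, ⟨⟨g, rfl⟩, hx⟩, rfl⟩
    exact ⟨⟨g, rfl⟩, by simpa [Subtype.dist_eq, dist_eq_norm, displacement] using hx⟩

theorem displacement_eq_zero (hH : RigidGroup H) {o : U} {g : H}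
    (h : displacement H o g = 0) : g = 1 := by
  refine hH.eq_of_apply_eq (o := o) ?_
  exact Subtype.ext (sub_eq_zero.1 h)

theorem nearlyAdditive_displacement (hH : RigidGroup H) (o : U) {C s R : ℝ} (hC : 0 ≤ C)
    (hs : 0 < s) (hR : 0 < R) (hRU : Metric.closedBall (o : W) R ⊆ U)
    (hle : ∀ g : H, ‖displacement H o g‖ < s → ∀ y : U, ‖(y : W) - o‖ < s →
      ‖(g.1 y : W) - y - displacement H o g‖ ≤ C * ‖displacement H o g‖ * ‖(y : W) - o‖) :
    ∃ t > 0, t ≤ R ∧ NearlyAdditive (displacement H o) C t := by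
  -- The estimate applies at `y = g⁻¹ o` only once this point is known to be near `o`; that follows
  -- from `g o → o`.
  have hinv : ∀ᶠ g in comap (displacement H o) (𝓝 0), ‖displacement H o g⁻¹‖ < s := by
    have hne : (comap (displacement H o) (𝓝 0)).NeBot :=
      comap_neBot fun t ht => ⟨1, by simpa [displacement] using mem_of_mem_nhds ht⟩
    have h1 : Tendsto (fun g : H => g.1 o) (comap (displacement H o) (𝓝 0)) (𝓝 o) := by
      rw [IsInducing.subtypeVal.tendsto_nhds_iff]
      have : Tendsto (fun g : H => displacement H o g + o) (comap (displacement H o) (𝓝 0))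
        (𝓝 (0 + (o : W))) := tendsto_comap.add tendsto_const_nhds
      simpa [displacement_add, Function.comp_def] using this
    have h2 := hH.tendsto_symm_apply (Φ := id) h1
    have h3 : Tendsto (fun g : H => ‖(g.1.symm o : W) - o‖) (comap (displacement H o) (𝓝 0))
        (𝓝 0) := by
      have hc : Continuous fun x : U => ‖(x : W) - o‖ := by fun_prop
      simpa [Function.comp_def] using (hc.tendsto o).comp h2
    exact h3.eventually (gt_mem_nhds hs)
  obtain ⟨T, hT, hTs⟩ := eventually_comap.1 hinv |> eventually_iff_exists_mem.1
  obtain ⟨ε, hε, hεT⟩ := Metric.mem_nhds_iff.1 hT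
  refine ⟨min (min s ε) (min R (1 / (2 * (C + 1)))), by positivity,
    (min_le_right _ _).trans (min_le_left _ _), ?_⟩
  set t := min (min s ε) (min R (1 / (2 * (C + 1)))) with ht
  have t1 : t ≤ s := (min_le_left _ _).trans (min_le_left _ _)
  have t2 : t ≤ ε := (min_le_left _ _).trans (min_le_right _ _)
  have t3 : t ≤ R := (min_le_right _ _).trans (min_le_left _ _)
  have t4 : C * t ≤ 1 / 2 := by
    have : t ≤ 1 / (2 * (C + 1)) := (min_le_right _ _).trans (min_le_right _ _)
    rw [le_div_iff₀ (by positivity)] at this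
    nlinarith [show 0 < t by positivity]
  refine ⟨hC, by positivity, by simp [displacement], fun g h hg hh => ?_, fun g hg => ?_,
    fun u hu => hH.isCompact_range_displacement o
      ((Metric.closedBall_subset_closedBall (hu.le.trans t3)).trans hRU)⟩
  · have := hle g (hg.trans_le t1) (h.1 o) (hh.trans_le t1)
    convert this using 2
    · simp only [displacement, Subgroup.coe_mul, Homeomorph.mul_apply]
      abel
    · rfl
  · have hi : ‖displacement H o g⁻¹‖ < s :=
      hTs _ (hεT (by simpa using hg.trans_le t2)) g rfl
    have := hle g (hg.trans_le t1) (g.1.symm o) hi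
    rw [Homeomorph.apply_symm_apply] at this
    have e1 : displacement H o g⁻¹ = (g.1.symm o : W) - o := rfl
    have h2 : ‖(g.1.symm o : W) - o‖ ≤
        ‖(o : W) - (g.1.symm o : W) - displacement H o g‖ + ‖displacement H o g‖ := by
      rw [norm_sub_rev]
      simpa using norm_add_le ((o : W) - (g.1.symm o : W) - displacement H o g)
        (displacement H o g)
    rw [e1]
    have h3 : C * ‖displacement H o g‖ * ‖(g.1.symm o : W) - o‖ ≤
        C * t * ‖(g.1.symm o : W) - o‖ := by gcongr
    nlinarith [norm_nonneg ((g.1.symm o : W) - o)]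

/-- The orbit of `o` is near `o` the image of a smooth section of a linear projection. -/
theorem exists_smooth_section (hH : RigidGroup H) (o : U) :
    ∃ k ≤ Module.finrank ℝ W, ∃ (P : W →L[ℝ] EuclideanSpace ℝ (Fin k))
      (B : Set (EuclideanSpace ℝ (Fin k))) (δ : ℝ) (γ : EuclideanSpace ℝ (Fin k) → H),
      IsOpen B ∧ 0 ∈ B ∧ 0 < δ ∧
      (∀ z ∈ B, P (displacement H o (γ z)) = z ∧ ‖displacement H o (γ z)‖ < δ) ∧
      ContDiffOn ℝ ∞ (fun z => displacement H o (γ z)) B ∧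
      ∀ g, ‖displacement H o g‖ < δ → P (displacement H o g) ∈ B →
        γ (P (displacement H o g)) = g := by
  obtain ⟨m, R, hR, hRU, hm, hform⟩ := hH.exists_local_product o
  obtain ⟨C, hC, s, hs, hsR, hle⟩ := exists_norm_apply_sub_le hR hRU hm hform
  obtain ⟨t, ht, htR, hna⟩ := hH.nearlyAdditive_displacement o hC hs hR hRU hle
  have ho : (o : W) ∈ Metric.ball (o : W) R := Metric.mem_ball_self hR
  have hL : ∀ w : W, ‖w‖ < R → w + (o : W) ∈ Metric.ball (o : W) R := fun w hw => by
    simpa [mem_ball_iff_norm] using hw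
  -- The differential of left translation by `g` at `o` depends on `g` only through `w = a g`.
  have hLs : ∀ᶠ w in 𝓝 (0 : W), ContDiffAt ℝ ∞ (fun w => sndDeriv m (w + (o : W), (o : W))) w := by
    have : ∀ᶠ w in 𝓝 (0 : W), ‖w‖ < R := by
      filter_upwards [Metric.ball_mem_nhds 0 hR] with w hw
      simpa using hw
    filter_upwards [this] with w hw
    exact (contDiffAt_sndDeriv (hm _ (hL w hw) o ho)).comp
      (f := fun w : W => (w + (o : W), (o : W))) w (by fun_prop)
  have hLd : ∀ g : H, ‖displacement H o g‖ < t →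
      (fun k => displacement H o (g * k) - displacement H o g -
        sndDeriv m (displacement H o g + o, o) (displacement H o k))
        =o[comap (displacement H o) (𝓝 0)] displacement H o := by
    intro g hg
    have hgo : (g.1 o : W) ∈ Metric.ball (o : W) R := by
      rw [← displacement_add]; exact hL _ (hg.trans_le htR)
    have hd := (hasFDerivAt_iff_isLittleO.1 (hasFDerivAt_snd (hm _ hgo o ho)))
    have htend : Tendsto (fun k : H => (k.1 o : W)) (comap (displacement H o) (𝓝 0))
        (𝓝 (o : W)) := by
      have : Tendsto (fun g : H => displacement H o g + o) (comap (displacement H o) (𝓝 0))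
        (𝓝 (0 + (o : W))) := tendsto_comap.add tendsto_const_nhds
      simpa [displacement_add] using this
    refine (hd.comp_tendsto htend).congr' ?_ ?_
    · filter_upwards [htend.eventually (Metric.ball_mem_nhds (o : W) hR)] with k hk
      simp only [Function.comp, displacement_add]
      rw [← hform g hgo (k.1 o) hk, ← hform g hgo o ho]
      simp only [displacement, Subgroup.coe_mul, Homeomorph.mul_apply]
      abel_nf
    · exact Eventually.of_forall fun k => rfl
  obtain ⟨k, hk, P, B, δ, γ, hB, h0B, hδ, h1, h2, h3⟩ := hna.exists_smooth_section hLs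
    (by simpa using sndDeriv_self hR hRU hm hform ho) hLd
  refine ⟨k, hk, P, B, δ, γ, hB, h0B, hδ, h1, h2, fun g hg hgB => ?_⟩
  exact (inv_mul_eq_one.1 (hH.displacement_eq_zero (h3 g hg hgB))).symm

end RigidGroup

/-! ### Lie group structure and smoothness of the action -/

namespace RigidGroup

set_option linter.unusedSectionVars false

open Filter

variable {W : Type*} [NormedAddCommGroup W] [NormedSpace ℝ W] {U : Opens W}
  {H : Subgroup (U ≃ₜ U)}

variable [FiniteDimensional ℝ W] [PreconnectedSpace U] [TopologicalSpace H]

/-- The chart at `g` of a rigid group, given by a smooth section of a projection. -/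
noncomputable def chart (hH : RigidGroup H)
    (hτ : IsInducing fun g : H => (⟨g.1, g.1.continuous⟩ : C(U, U))) (o : U) {E : Type*}
    [NormedAddCommGroup E] [NormedSpace ℝ E] {P : W →L[ℝ] E} {B : Set E} {δ : ℝ} {γ : E → H}
    (hB : IsOpen B)
    (h1 : ∀ z ∈ B, P (displacement H o (γ z)) = z ∧ ‖displacement H o (γ z)‖ < δ)
    (h2 : ContDiffOn ℝ ∞ (fun z => displacement H o (γ z)) B)
    (h3 : ∀ g, ‖displacement H o g‖ < δ → P (displacement H o g) ∈ B →
        γ (P (displacement H o g)) = g) (g : H) : OpenPartialHomeomorph H E where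
  toFun h := P (displacement H o (g⁻¹ * h))
  invFun z := g * γ z
  source := {h | ‖displacement H o (g⁻¹ * h)‖ < δ ∧ P (displacement H o (g⁻¹ * h)) ∈ B}
  target := B
  map_source' h hh := hh.2
  map_target' z hz := by simpa [(h1 z hz).1, (h1 z hz).2] using hz
  left_inv' h hh := by simp only [h3 _ hh.1 hh.2, mul_inv_cancel_left]
  right_inv' z hz := by simp [(h1 z hz).1]
  open_source := by
    have hc : Continuous fun h : H => displacement H o (g⁻¹ * h) :=
      ((continuous_subtype_val.comp (g⁻¹).1.continuous).comp
        (hH.isEmbedding_apply hτ o).continuous).sub continuous_const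
    exact (isOpen_lt hc.norm continuous_const).inter (hB.preimage (P.continuous.comp hc))
  open_target := hB
  continuousOn_toFun := by
    have hc : Continuous fun h : H => displacement H o (g⁻¹ * h) :=
      ((continuous_subtype_val.comp (g⁻¹).1.continuous).comp
        (hH.isEmbedding_apply hτ o).continuous).sub continuous_const
    exact (P.continuous.comp hc).continuousOn
  continuousOn_invFun := by
    rw [(hH.isEmbedding_apply hτ o).isInducing.continuousOn_iff]
    have : ContinuousOn (fun z => (γ z).1 o) B := by
      rw [IsInducing.subtypeVal.continuousOn_iff]
      refine (h2.continuousOn.add (continuousOn_const (c := (o : W)))).congr fun z _ => ?_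
      simp [displacement]
    exact g.1.continuous.comp_continuousOn this

/-- A rigid group has the structure of a manifold such that the map to the orbit of `o` is smooth
and has local smooth left inverses. -/
theorem exists_chartedSpace (hH : RigidGroup H)
    (hτ : IsInducing fun g : H => (⟨g.1, g.1.continuous⟩ : C(U, U))) (o : U) :
    ∃ k ≤ Module.finrank ℝ W, ∃ _ : ChartedSpace (EuclideanSpace ℝ (Fin k)) H,
      IsManifold (𝓡 k) ∞ H ∧ ContMDiff (𝓡 k) 𝓘(ℝ, W) ∞ (fun g : H => g.1 o) ∧
      ∀ g : H, ∃ π : U → H, ContMDiffAt 𝓘(ℝ, W) (𝓡 k) ∞ π (g.1 o) ∧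
        ∀ᶠ h in 𝓝 g, π (h.1 o) = h := by
  obtain ⟨k, hk, P, B, δ, γ, hB, h0B, hδ, h1, h2, h3⟩ := hH.exists_smooth_section o
  let e := hH.chart hτ o hB h1 h2 h3
  have hsrc : ∀ g, g ∈ (e g).source := fun g => by
    simp [e, chart, displacement, hδ, h0B]
  let cs : ChartedSpace (EuclideanSpace ℝ (Fin k)) H :=
    { atlas := range e
      chartAt := e
      mem_chart_source := hsrc
      chart_mem_atlas := fun g => ⟨g, rfl⟩ }
  have hsec : ContMDiffOn (𝓡 k) 𝓘(ℝ, W) ∞ (fun z => (γ z).1 o) B := by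
    intro z hz
    rw [← ContMDiffWithinAt.subtypeVal_comp_iff]
    refine ContDiffWithinAt.contMDiffWithinAt ?_
    refine ((h2 z hz).add (contDiffWithinAt_const (c := (o : W)))).congr (fun z _ => ?_) ?_ <;>
    simp [displacement]
  have hproj : ∀ g : H, ContMDiff 𝓘(ℝ, W) (𝓡 k) ∞ fun x : U => P ((g.1 x : W) - o) := by
    intro g
    have h4 : ContMDiff 𝓘(ℝ, W) (𝓡 k) ∞ fun w : W => P (w - o) := by
      refine ContDiff.contMDiff ?_
      fun_prop
    exact h4.comp (contMDiff_subtype_val.comp (hH.contMDiff_apply g))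
  have hman : IsManifold (𝓡 k) ∞ H := by
    refine isManifold_of_contDiffOn _ _ _ ?_
    rintro _ _ ⟨g, rfl⟩ ⟨g', rfl⟩
    -- A change of charts is the section, followed by one fixed group element and the projection,
    -- all of them smooth.
    have h5 : ContMDiffOn (𝓡 k) (𝓡 k) ∞ (fun z => P (((g'⁻¹ * g).1 ((γ z).1 o) : W) - o)) B :=
      (hproj (g'⁻¹ * g)).comp_contMDiffOn hsec
    refine (contMDiffOn_iff_contDiffOn.1 h5).mono ?_ |>.congr ?_
    · rintro z ⟨hz, -⟩
      exact hz.1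
    · intro z hz
      simp [e, chart, displacement]
  refine ⟨k, hk, cs, hman, fun g => ?_, fun g => ?_⟩
  · have hch : ContMDiffAt (𝓡 k) (𝓡 k) ∞ (e g) g := contMDiffAt_of_mem_maximalAtlas
      (IsManifold.subset_maximalAtlas ⟨g, rfl⟩) (hsrc g)
    have hz : e g g ∈ B := (e g).map_source (hsrc g)
    have h6 : ContMDiffAt (𝓡 k) 𝓘(ℝ, W) ∞ (fun z => g.1 ((γ z).1 o)) (e g g) :=
      (hH.contMDiff_apply g _).comp _ (hsec.contMDiffAt (hB.mem_nhds hz))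
    refine (h6.comp g hch).congr_of_eventuallyEq ?_
    filter_upwards [(e g).open_source.mem_nhds (hsrc g)] with h hh
    exact (congrArg (fun h : H => h.1 o) ((e g).left_inv hh)).symm
  · have hz : P (((g⁻¹).1 (g.1 o) : W) - o) ∈ B := by
      have : (g⁻¹).1 (g.1 o) = o := g.1.symm_apply_apply o
      simpa [this] using h0B
    refine ⟨fun x => (e g).symm (P (((g⁻¹).1 x : W) - o)), ?_, ?_⟩
    · have h7 : ContMDiffAt (𝓡 k) (𝓡 k) ∞ (e g).symm (P (((g⁻¹).1 (g.1 o) : W) - o)) :=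
        contMDiffAt_symm_of_mem_maximalAtlas (IsManifold.subset_maximalAtlas ⟨g, rfl⟩) hz
      exact h7.comp (g.1 o) (hproj g⁻¹ (g.1 o))
    · filter_upwards [(e g).open_source.mem_nhds (hsrc g)] with h hh
      exact (e g).left_inv hh

/-- A rigid group is a Lie group acting smoothly. -/
theorem exists_lieGroup (hH : RigidGroup H)
    (hτ : IsInducing fun g : H => (⟨g.1, g.1.continuous⟩ : C(U, U))) (o : U) :
    ∃ k ≤ Module.finrank ℝ W, ∃ _ : ChartedSpace (EuclideanSpace ℝ (Fin k)) H,
      LieGroup (𝓡 k) ∞ H ∧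
      ContMDiff ((𝓡 k).prod 𝓘(ℝ, W)) 𝓘(ℝ, W) ∞ (fun q : H × U => q.1.1 q.2) := by
  obtain ⟨k, hk, cs, hman, hev, hret⟩ := hH.exists_chartedSpace hτ o
  refine ⟨k, hk, cs, ?_⟩
  have hemb := hH.isEmbedding_apply hτ o
  -- Smoothness into the group can be tested on the orbit: the embedding gives continuity, and a
  -- local smooth left inverse recovers the map.
  have lift : ∀ {E' H' M : Type _} [NormedAddCommGroup E'] [NormedSpace ℝ E'] [TopologicalSpace H']
      {I : ModelWithCorners ℝ E' H'} [TopologicalSpace M] [ChartedSpace H' M] {F : M → H} {x : M},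
      ContMDiffAt I 𝓘(ℝ, W) ∞ (fun y => (F y).1 o) x → ContMDiffAt I (𝓡 k) ∞ F x := by
    intro E' H' M _ _ _ I _ _ F x hF
    obtain ⟨π, hπ, hπ'⟩ := hret (F x)
    have hcont : ContinuousAt F x := hemb.isInducing.continuousAt_iff.2 hF.continuousAt
    refine (hπ.comp x hF).congr_of_eventuallyEq ?_
    filter_upwards [hcont.eventually hπ'] with y hy
    exact hy.symm
  have hleft : ∀ g : H, ContMDiff (𝓡 k) (𝓡 k) ∞ (fun h => g * h) := fun g h =>
    lift ((hH.contMDiff_apply g _).comp h (hev h))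
  have hevc : ∀ x : U, Tendsto (fun g : H => g.1 x) (𝓝 1) (𝓝 x) := fun x =>
    ((continuous_eval_const (F := C(U, U)) x).comp hτ.continuous).tendsto 1
  have hstep : ∀ {x y : U} {E : W × W × W → W}, ContDiffAt ℝ ∞ E (x, x, y) →
      (∀ᶠ z : U × U × U in 𝓝 (x, x, y), ∀ g ∈ H, g z.1 = z.2.1 →
        (g z.2.2 : W) = E (z.1, z.2.1, z.2.2)) →
      ContMDiffAt (𝓡 k) 𝓘(ℝ, W) ∞ (fun g : H => g.1 x) 1 →
      ContMDiffAt ((𝓡 k).prod 𝓘(ℝ, W)) 𝓘(ℝ, W) ∞ (fun q : H × U => q.1.1 q.2) (1, y) := by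
    intro x y E hE hform hx
    rw [← ContMDiffAt.subtypeVal_comp_iff]
    have h1 : ContMDiffAt ((𝓡 k).prod 𝓘(ℝ, W)) 𝓘(ℝ, W × W × W) ∞
        (fun q : H × U => ((x : W), (q.1.1 x : W), (q.2 : W))) (1, y) := by
      refine contMDiffAt_const.prodMk_space (ContMDiffAt.prodMk_space ?_ ?_)
      · exact (contMDiff_subtype_val _).comp (1, y)
          (ContMDiffAt.comp (g := fun g : H => g.1 x) (1, y) hx contMDiffAt_fst)
      · exact (contMDiff_subtype_val _).comp (1, y) contMDiffAt_snd
    refine (ContMDiffAt.comp (g := E) (1, y) hE.contMDiffAt h1).congr_of_eventuallyEq ?_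
    have hc : Tendsto (fun q : H × U => (x, q.1.1 x, q.2)) (𝓝 (1, y)) (𝓝 (x, x, y)) :=
      tendsto_const_nhds.prodMk_nhds
        (((hevc x).comp (continuous_fst.tendsto (1, y))).prodMk_nhds
          (continuous_snd.tendsto (1, y)))
    filter_upwards [hc.eventually hform] with q hq
    exact hq q.1.1 q.1.2 rfl
  have hpt : ∀ x : U,
      ContMDiffAt ((𝓡 k).prod 𝓘(ℝ, W)) 𝓘(ℝ, W) ∞ (fun q : H × U => q.1.1 q.2) (1, x) →
      ContMDiffAt (𝓡 k) 𝓘(ℝ, W) ∞ (fun g : H => g.1 x) 1 := fun x hx =>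
    ContMDiffAt.comp (g := fun q : H × U => q.1.1 q.2) (f := fun g : H => (g, x)) 1 hx
      (contMDiffAt_id.prodMk contMDiffAt_const)
  have hnear : ∀ q : U, ∃ N : Set U, IsOpen N ∧ q ∈ N ∧ ∀ x ∈ N, ∀ y ∈ N,
      ContMDiffAt (𝓡 k) 𝓘(ℝ, W) ∞ (fun g : H => g.1 x) 1 →
      ContMDiffAt ((𝓡 k).prod 𝓘(ℝ, W)) 𝓘(ℝ, W) ∞ (fun q : H × U => q.1.1 q.2) (1, y) := by
    intro q
    obtain ⟨E, hE, -, hform⟩ := hH.exists_formula q q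
    have hE' : ∀ᶠ z : U × U in 𝓝 (q, q), ContDiffAt ℝ ∞ E (z.1, z.1, z.2) := by
      have hc : Continuous fun z : U × U => ((z.1 : W), (z.1 : W), (z.2 : W)) := by fun_prop
      exact (hc.tendsto (q, q)).eventually hE
    have hform' : ∀ᶠ z : U × U in 𝓝 (q, q), ∀ᶠ z' : U × U × U in 𝓝 (z.1, z.1, z.2),
        ∀ g ∈ H, g z'.1 = z'.2.1 → (g z'.2.2 : W) = E (z'.1, z'.2.1, z'.2.2) := by
      have hc : Continuous fun z : U × U => (z.1, z.1, z.2) := by fun_prop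
      exact (hc.tendsto (q, q)).eventually hform.eventually_nhds
    obtain ⟨N₁, N₂, hN₁, h₁, hN₂, h₂, hN⟩ := mem_nhds_prod_iff'.1 (hE'.and hform')
    exact ⟨N₁ ∩ N₂, hN₁.inter hN₂, ⟨h₁, h₂⟩, fun x hx y hy =>
      have hxy := hN (show (x, y) ∈ N₁ ×ˢ N₂ from ⟨hx.1, hy.2⟩)
      hstep hxy.1 hxy.2⟩
  -- Smoothness of the orbit map at `1` is known for `o` only; the local formula spreads it,
  -- together with that of the action at `(1, q)`, over the connected set `U`.
  have hone : ∀ q : U,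
      ContMDiffAt ((𝓡 k).prod 𝓘(ℝ, W)) 𝓘(ℝ, W) ∞ (fun q : H × U => q.1.1 q.2) (1, q) := by
    have hclopen : IsClopen {q : U |
        ContMDiffAt ((𝓡 k).prod 𝓘(ℝ, W)) 𝓘(ℝ, W) ∞ (fun q : H × U => q.1.1 q.2) (1, q)} := by
      constructor
      · rw [← closure_subset_iff_isClosed]
        intro q hq
        obtain ⟨N, hN, hqN, h⟩ := hnear q
        obtain ⟨x, hxN, hx⟩ := mem_closure_iff.1 hq N hN hqN
        exact h x hxN q hqN (hpt x hx)
      · rw [isOpen_iff_mem_nhds]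
        intro q hq
        obtain ⟨N, hN, hqN, h⟩ := hnear q
        filter_upwards [hN.mem_nhds hqN] with y hy
        exact h q hqN y hy (hpt q hq)
    have hne := hclopen.eq_univ (by
      obtain ⟨N, hN, hoN, h⟩ := hnear o
      exact ⟨o, h o hoN o hoN (hev 1)⟩)
    exact eq_univ_iff_forall.1 hne
  have hact : ContMDiff ((𝓡 k).prod 𝓘(ℝ, W)) 𝓘(ℝ, W) ∞ (fun q : H × U => q.1.1 q.2) := by
    rintro ⟨g, q⟩
    have h1 : ContMDiffAt ((𝓡 k).prod 𝓘(ℝ, W)) ((𝓡 k).prod 𝓘(ℝ, W)) ∞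
        (fun z : H × U => (g⁻¹ * z.1, z.2)) (g, q) :=
      ((hleft g⁻¹ g).comp (g, q) contMDiffAt_fst).prodMk contMDiffAt_snd
    have h2 : ContMDiffAt ((𝓡 k).prod 𝓘(ℝ, W)) 𝓘(ℝ, W) ∞
        (fun q : H × U => q.1.1 q.2) (g⁻¹ * g, q) := by
      rw [inv_mul_cancel]; exact hone q
    refine ((hH.contMDiff_apply g _).comp (g, q)
      (ContMDiffAt.comp (g := fun q : H × U => q.1.1 q.2) (g, q) h2 h1)).congr_of_eventuallyEq ?_
    refine Eventually.of_forall fun z => ?_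
    exact (g.1.apply_symm_apply (z.1.1 z.2)).symm
  -- Since `g⁻¹` sends `g o` to `o`, the formula reads `g⁻¹ o = E (g o, o, o)`.
  have hinv1 : ContMDiffAt (𝓡 k) (𝓡 k) ∞ (fun g : H => g⁻¹) 1 := by
    refine lift ?_
    rw [← ContMDiffAt.subtypeVal_comp_iff]
    obtain ⟨E, hE, -, hform⟩ := hH.exists_formula o o
    have h1 : ContMDiffAt (𝓡 k) 𝓘(ℝ, W × W × W) ∞
        (fun g : H => ((g.1 o : W), (o : W), (o : W))) 1 :=
      ((contMDiff_subtype_val _).comp 1 (hev 1)).prodMk_space contMDiffAt_const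
    refine (ContMDiffAt.comp (g := E) 1 (hE.self_of_nhds).contMDiffAt h1).congr_of_eventuallyEq ?_
    have hc : Tendsto (fun g : H => (g.1 o, o, o)) (𝓝 1) (𝓝 (o, o, o)) :=
      (hevc o).prodMk_nhds tendsto_const_nhds
    filter_upwards [hc.eventually hform] with g hg
    exact hg (g⁻¹).1 (g⁻¹).2 (g.1.symm_apply_apply o)
  refine ⟨{ hman with contMDiff_mul := fun z => lift ?_, contMDiff_inv := fun g => lift ?_ }, hact⟩
  · exact ContMDiffAt.comp (g := fun q : H × U => q.1.1 q.2) z (hact _)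
      (contMDiffAt_fst.prodMk ((hev z.2).comp z contMDiffAt_snd))
  · have h1 : ContMDiffAt (𝓡 k) (𝓡 k) ∞ (fun h : H => (g⁻¹ * h)⁻¹) g := by
      refine ContMDiffAt.comp (g := fun h : H => h⁻¹) g ?_ (hleft g⁻¹ g)
      rw [inv_mul_cancel]; exact hinv1
    have h2 := ContMDiffAt.comp (g := fun q : H × U => q.1.1 q.2) g (hact _)
      (h1.prodMk (contMDiffAt_const (c := (g⁻¹).1 o)))
    refine h2.congr_of_eventuallyEq (Eventually.of_forall fun h => ?_)
    have : h⁻¹ = (g⁻¹ * h)⁻¹ * g⁻¹ := by group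
    simp only [Function.comp]
    exact congrArg (fun h : H => h.1 o) this

end RigidGroup

/-! ### Smooth dependence of integrals on parameters, and local solutions of equations -/

section ParametricIntegral

open Filter MeasureTheory

variable {X F : Type} [NormedAddCommGroup X] [NormedSpace ℝ X] [NormedAddCommGroup F]
  [NormedSpace ℝ F]

/-- The partial derivative of `G` in the first variable. -/
noncomputable def fstDeriv (G : X × ℝ → F) (z : X × ℝ) : X →L[ℝ] F :=
  (fderiv ℝ G z).comp (ContinuousLinearMap.inl ℝ X ℝ)

theorem contDiffOn_fstDeriv {G : X × ℝ → F} {O : Set (X × ℝ)} (hO : IsOpen O)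
    (hG : ContDiffOn ℝ ∞ G O) : ContDiffOn ℝ ∞ (fstDeriv G) O :=
  (hG.fderiv_of_isOpen hO (m := ∞) (by simp)).clm_comp contDiffOn_const

theorem hasFDerivAt_parametric_integral {G : X × ℝ → F} {O : Set (X × ℝ)}
    (hO : IsOpen O) (hG : ContDiffOn ℝ ∞ G O) {Ω : Set X} (hΩ : IsOpen Ω)
    (hΩO : ∀ x ∈ Ω, ∀ θ ∈ Icc (0 : ℝ) 1, (x, θ) ∈ O) {x₀ : X} (hx₀ : x₀ ∈ Ω) :
    HasFDerivAt (fun x => ∫ θ in (0 : ℝ)..1, G (x, θ)) (∫ θ in (0 : ℝ)..1, fstDeriv G (x₀, θ))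
      x₀ := by
  have hcont : ∀ {F' : Type} [NormedAddCommGroup F'] [NormedSpace ℝ F'] {G' : X × ℝ → F'},
      ContDiffOn ℝ ∞ G' O → ∀ x ∈ Ω, ContinuousOn (fun θ => G' (x, θ)) (Icc 0 1) :=
    fun hG' x hx => hG'.continuousOn.comp (by fun_prop) (fun θ hθ => hΩO x hx θ hθ)
  have hD := contDiffOn_fstDeriv hO hG
  obtain ⟨M, hM⟩ := (isCompact_Icc.image_of_continuousOn (hcont hD x₀ hx₀).norm).bddAbove
  -- The tube lemma turns the bound on the compact fibre over `x₀` into one on nearby fibres, which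
  -- serves as the dominating constant.
  have hopen : IsOpen (O ∩ {z | ‖fstDeriv G z‖ < M + 1}) := by
    have := hD.continuousOn.norm.isOpen_inter_preimage hO (isOpen_Iio (a := M + 1))
    exact this
  have hsub : ({x₀} : Set X) ×ˢ Icc (0 : ℝ) 1 ⊆ O ∩ {z | ‖fstDeriv G z‖ < M + 1} := by
    rintro ⟨x, θ⟩ ⟨rfl, hθ⟩
    refine ⟨hΩO _ hx₀ θ hθ, ?_⟩
    have := hM ⟨θ, hθ, rfl⟩
    simp only [mem_ofPred_eq]
    linarith
  obtain ⟨V, T, hV, -, hxV, hT, hVT⟩ :=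
    generalized_tube_lemma isCompact_singleton isCompact_Icc hopen hsub
  have hV' : V ∩ Ω ∈ 𝓝 x₀ := (hV.inter hΩ).mem_nhds ⟨hxV rfl, hx₀⟩
  have hIoc : uIoc (0 : ℝ) 1 ⊆ Icc 0 1 := by
    rw [uIoc_of_le zero_le_one]; exact Ioc_subset_Icc_self
  have hmeas : ∀ {F' : Type} [NormedAddCommGroup F'] [NormedSpace ℝ F'] {G' : X × ℝ → F'},
      ContDiffOn ℝ ∞ G' O → ∀ x ∈ Ω,
        AEStronglyMeasurable (fun θ => G' (x, θ)) (volume.restrict (uIoc 0 1)) :=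
    fun hG' x hx => ((hcont hG' x hx).aestronglyMeasurable measurableSet_Icc).mono_set hIoc
  refine intervalIntegral.hasFDerivAt_integral_of_dominated_of_fderiv_le
    (F' := fun x θ => fstDeriv G (x, θ)) (bound := fun _ => M + 1) hV' ?_ ?_ ?_ ?_ ?_ ?_
  · filter_upwards [hV'] with x hx
    exact hmeas hG x hx.2
  · refine ContinuousOn.intervalIntegrable ?_
    rw [uIcc_of_le zero_le_one]
    exact hcont hG x₀ hx₀
  · exact hmeas hD x₀ hx₀
  · refine ae_of_all _ fun θ hθ x hx => ?_
    exact (hVT ⟨hx.1, hT (hIoc hθ)⟩).2.le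
  · exact intervalIntegrable_const
  · refine ae_of_all _ fun θ hθ x hx => ?_
    have h1 : HasFDerivAt G (fderiv ℝ G (x, θ)) (x, θ) :=
      ((hG.contDiffAt (hO.mem_nhds (hΩO x hx.2 θ (hIoc hθ)))).differentiableAt
        (by simp)).hasFDerivAt
    exact HasFDerivAt.comp (f := fun x => (x, θ)) x h1 (hasFDerivAt_prodMk_left x θ)

theorem contDiffOn_parametric_integral {G : X × ℝ → F} {O : Set (X × ℝ)}
    (hO : IsOpen O) (hG : ContDiffOn ℝ ∞ G O) {Ω : Set X} (hΩ : IsOpen Ω)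
    (hΩO : ∀ x ∈ Ω, ∀ θ ∈ Icc (0 : ℝ) 1, (x, θ) ∈ O) :
    ContDiffOn ℝ ∞ (fun x => ∫ θ in (0 : ℝ)..1, G (x, θ)) Ω := by
  rw [contDiffOn_infty]
  intro n
  -- The derivative is again such an integral, with values in `X →L[ℝ] F`, so the codomain must
  -- vary.
  induction n generalizing F with
  | zero =>
    exact contDiffOn_zero.2 fun x hx =>
      (hasFDerivAt_parametric_integral hO hG hΩ hΩO hx).continuousAt.continuousWithinAt
  | succ n ih =>
    rw [Nat.cast_succ, contDiffOn_succ_iff_fderiv_of_isOpen hΩ]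
    refine ⟨fun x hx => (hasFDerivAt_parametric_integral hO hG hΩ
      hΩO hx).differentiableAt.differentiableWithinAt, by simp, ?_⟩
    exact (ih (contDiffOn_fstDeriv hO hG)).congr fun x hx =>
      (hasFDerivAt_parametric_integral hO hG hΩ hΩO hx).fderiv

/-- A smooth local solution `s = S (x, τ)` of the equation `Φ (x, s) = τ`. -/
theorem exists_local_solution [CompleteSpace X] {Φ : X × ℝ → ℝ} {z₀ : X × ℝ}
    (hΦ : ∀ᶠ z in 𝓝 z₀, ContDiffAt ℝ ∞ Φ z) (hΦ' : ∀ᶠ z in 𝓝 z₀, fderiv ℝ Φ z (0, 1) ≠ 0) :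
    ∃ S : X × ℝ → ℝ, (∀ᶠ w in 𝓝 (z₀.1, Φ z₀), ContDiffAt ℝ ∞ S w) ∧
      ∀ᶠ z in 𝓝 z₀, S (z.1, Φ z) = z.2 := by
  -- The inverse function theorem for this map yields the solution as the last component of its
  -- inverse.
  set Θ : X × ℝ → X × ℝ := fun z => (z.1, Φ z) with hΘ
  have hΘs : ∀ z, ContDiffAt ℝ ∞ Φ z → ContDiffAt ℝ ∞ Θ z := fun z hz =>
    contDiffAt_fst.prodMk hz
  have hder : ∀ z, ContDiffAt ℝ ∞ Φ z → fderiv ℝ Φ z (0, 1) ≠ 0 →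
      ∃ e : (X × ℝ) ≃L[ℝ] (X × ℝ), HasFDerivAt Θ (e : X × ℝ →L[ℝ] X × ℝ) z := by
    intro z hz hβ
    set L := fderiv ℝ Φ z with hL
    set β := L (0, 1) with hβdef
    have hLapp : ∀ v τ, L (v, τ) = L (v, 0) + τ * β := by
      intro v τ
      have : ((v, τ) : X × ℝ) = (v, 0) + τ • (0, 1) := by simp
      rw [this, map_add, map_smul, smul_eq_mul]
    refine ⟨ContinuousLinearEquiv.equivOfInverse
      ((ContinuousLinearMap.fst ℝ X ℝ).prod L)
      ((ContinuousLinearMap.fst ℝ X ℝ).prod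
        (β⁻¹ • (ContinuousLinearMap.snd ℝ X ℝ -
          (L.comp (ContinuousLinearMap.inl ℝ X ℝ)).comp (ContinuousLinearMap.fst ℝ X ℝ))))
      ?_ ?_, ?_⟩
    · rintro ⟨v, τ⟩
      ext
      · simp
      · simp [hLapp v τ]
        field_simp
    · rintro ⟨v, τ⟩
      ext
      · simp
      · change L (v, β⁻¹ * (τ - L (v, 0))) = τ
        rw [hLapp]
        field_simp
        ring
    · exact hasFDerivAt_fst.prodMk (hz.differentiableAt (by simp)).hasFDerivAt
  obtain ⟨e₀, he₀⟩ := hder z₀ hΦ.self_of_nhds hΦ'.self_of_nhds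
  set h := (hΘs z₀ hΦ.self_of_nhds).toOpenPartialHomeomorph Θ he₀ (by simp) with hh
  have hsrc : z₀ ∈ h.source := ContDiffAt.mem_toOpenPartialHomeomorph_source _ he₀ (by simp)
  have htgt : Θ z₀ ∈ h.target := h.map_source hsrc
  refine ⟨fun w => (h.symm w).2, ?_, ?_⟩
  · have hback : Tendsto h.symm (𝓝 (Θ z₀)) (𝓝 z₀) := by
      have := (h.continuousAt_symm htgt).tendsto
      rwa [show h.symm (Θ z₀) = z₀ from h.left_inv hsrc] at this
    filter_upwards [h.open_target.mem_nhds htgt, hback.eventually hΦ, hback.eventually hΦ']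
      with w hw h1 h2
    obtain ⟨e, he⟩ := hder _ h1 h2
    exact contDiffAt_snd.comp w (h.contDiffAt_symm hw he (hΘs _ h1))
  · filter_upwards [h.open_source.mem_nhds hsrc] with z hz
    exact congrArg Prod.snd (h.left_inv hz)

end ParametricIntegral

/-! ### Primitives along coordinate lines -/

section LineIntegral

open Filter Function

variable {n : ℕ}

/-- The integral of `g` along the segment in direction `i` from `y` to the point with `i`-th
coordinate `s`. -/
noncomputable def lineIntegral (g : (Fin n → ℝ) → ℝ) (i : Fin n) (z : (Fin n → ℝ) × ℝ) : ℝ :=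
  ∫ u in (z.1 i)..z.2, g (update z.1 i u)

theorem lineIntegral_self (g : (Fin n → ℝ) → ℝ) (i : Fin n) (y : Fin n → ℝ) :
    lineIntegral g i (y, y i) = 0 := by
  simp [lineIntegral]

theorem update_mem_ball {y c : Fin n → ℝ} {i : Fin n} {u r : ℝ} (hy : y ∈ Metric.ball c r)
    (hu : u ∈ Metric.ball (c i) r) : update y i u ∈ Metric.ball c r := by
  have hr : 0 < r := Metric.pos_of_mem_ball hy
  rw [Metric.mem_ball, dist_pi_lt_iff hr] at hy ⊢
  intro k
  by_cases hk : k = i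
  · subst hk; simpa using hu
  · simpa [hk] using hy k

theorem contDiffAt_lineIntegral {g : (Fin n → ℝ) → ℝ} {c : Fin n → ℝ} {r : ℝ}
    (hg : ContDiffOn ℝ ∞ g (Metric.ball c r)) (i : Fin n) {z : (Fin n → ℝ) × ℝ}
    (hz : z ∈ Metric.ball c r ×ˢ Metric.ball (c i) r) : ContDiffAt ℝ ∞ (lineIntegral g i) z := by
  -- Rescaling to `[0, 1]` moves the variable endpoints into the integrand.
  have heq : lineIntegral g i = fun z => (z.2 - z.1 i) *
      ∫ θ in (0 : ℝ)..1, g (update z.1 i (z.1 i + (z.2 - z.1 i) * θ)) := by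
    funext z
    rw [intervalIntegral.mul_integral_comp_add_mul (f := fun u => g (update z.1 i u))]
    simp [lineIntegral]
  have hΩ : IsOpen (Metric.ball c r ×ˢ Metric.ball (c i) r) :=
    Metric.isOpen_ball.prod Metric.isOpen_ball
  set m : ((Fin n → ℝ) × ℝ) × ℝ → (Fin n → ℝ) :=
    fun w => update w.1.1 i (w.1.1 i + (w.1.2 - w.1.1 i) * w.2) with hm
  have hms : ContDiff ℝ ∞ m := by
    rw [contDiff_pi]
    intro k
    by_cases hk : k = i
    · subst hk; simp only [hm, update_self]; fun_prop
    · simp only [hm, update_of_ne hk]; fun_prop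
  rw [heq]
  refine ContDiffAt.mul (by fun_prop) ?_
  have := contDiffOn_parametric_integral (G := fun w => g (m w))
    (O := m ⁻¹' Metric.ball c r) (Metric.isOpen_ball.preimage hms.continuous)
    (hg.comp hms.contDiffOn fun w hw => hw) hΩ ?_
  · exact this.contDiffAt (hΩ.mem_nhds hz)
  · rintro ⟨y, s⟩ ⟨hy, hs⟩ θ hθ
    refine update_mem_ball hy ?_
    have hyi : y i ∈ Metric.ball (c i) r := by
      rw [Metric.mem_ball] at hy ⊢
      exact (dist_le_pi_dist y c i).trans_lt hy
    have := (convex_ball (c i) r) hyi hs (a := 1 - θ) (b := θ) (by linarith [hθ.2]) hθ.1 (by ring)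
    convert this using 1
    simp only [smul_eq_mul]
    ring

theorem hasDerivAt_lineIntegral {g : (Fin n → ℝ) → ℝ} {c : Fin n → ℝ} {r : ℝ}
    (hg : ContinuousOn g (Metric.ball c r)) (i : Fin n) {y : Fin n → ℝ} {s : ℝ}
    (hy : y ∈ Metric.ball c r) (hs : s ∈ Metric.ball (c i) r) :
    HasDerivAt (fun s => lineIntegral g i (y, s)) (g (update y i s)) s := by
  have hyi : y i ∈ Metric.ball (c i) r := by
    rw [Metric.mem_ball] at hy ⊢
    exact (dist_le_pi_dist y c i).trans_lt hy
  have hcont : ContinuousOn (fun u => g (update y i u)) (Metric.ball (c i) r) :=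
    hg.comp (by fun_prop) fun u hu => update_mem_ball hy hu
  have hsub : uIcc (y i) s ⊆ Metric.ball (c i) r := by
    rw [← segment_eq_uIcc]
    exact (convex_ball (c i) r).segment_subset hyi hs
  refine intervalIntegral.integral_hasDerivAt_right ((hcont.mono hsub).intervalIntegrable) ?_
    (hcont.continuousAt (Metric.isOpen_ball.mem_nhds hs))
  exact hcont.stronglyMeasurableAtFilter Metric.isOpen_ball s hs

/-- The equation `lineIntegral g i (y, s) = τ` has a smooth local solution `s`. -/
theorem exists_lineIntegral_solution {g : (Fin n → ℝ) → ℝ} {c : Fin n → ℝ} {r : ℝ} (hr : 0 < r)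
    (hg : ContDiffOn ℝ ∞ g (Metric.ball c r)) (hg0 : ∀ y ∈ Metric.ball c r, g y ≠ 0) (i : Fin n) :
    ∃ S : (Fin n → ℝ) × ℝ → ℝ, (∀ᶠ w in 𝓝 (c, (0 : ℝ)), ContDiffAt ℝ ∞ S w) ∧ S (c, 0) = c i ∧
      ∀ᶠ z in 𝓝 (c, c i), S (z.1, lineIntegral g i z) = z.2 := by
  have hmem : Metric.ball c r ×ˢ Metric.ball (c i) r ∈ 𝓝 (c, c i) :=
    prod_mem_nhds (Metric.ball_mem_nhds _ hr) (Metric.ball_mem_nhds _ hr)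
  obtain ⟨S, hS, hS'⟩ := exists_local_solution (Φ := lineIntegral g i) (z₀ := (c, c i))
    (by filter_upwards [hmem] with z hz using contDiffAt_lineIntegral hg i hz) (by
      filter_upwards [hmem] with z hz
      have h1 := (contDiffAt_lineIntegral hg i hz).differentiableAt (by simp)
      have h2 : HasDerivAt (fun s => lineIntegral g i (z.1, s))
          (fderiv ℝ (lineIntegral g i) z (0, 1)) z.2 :=
        HasFDerivAt.comp_hasDerivAt (f := fun s => (z.1, s)) z.2 h1.hasFDerivAt
          ((hasDerivAt_const z.2 z.1).prodMk (hasDerivAt_id z.2))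
      rw [h2.unique (hasDerivAt_lineIntegral hg.continuousOn i hz.1 hz.2)]
      exact hg0 _ (update_mem_ball hz.1 hz.2))
  rw [lineIntegral_self] at hS
  refine ⟨S, hS, ?_, hS'⟩
  have := hS'.self_of_nhds
  rwa [lineIntegral_self] at this

end LineIntegral

/-! ### Derivatives of web transformations -/

section OpenSubset

open Filter

variable {W : Type*} [NormedAddCommGroup W] [NormedSpace ℝ W] {U : Opens W}

theorem hasMFDerivAt_subtype_val (p : U) :
    HasMFDerivAt 𝓘(ℝ, W) 𝓘(ℝ, W) (Subtype.val : U → W) p (ContinuousLinearMap.id ℝ W) := by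
  refine ⟨continuous_subtype_val.continuousAt, ?_⟩
  have hx : extChartAt 𝓘(ℝ, W) p p = (p : W) := by simp [extChartAt]; rfl
  rw [hx]
  refine (HasFDerivAt.congr_of_eventuallyEq (hasFDerivAt_id (p : W)) ?_).hasFDerivWithinAt
  filter_upwards [U.isOpen.mem_nhds p.2] with y hy
  simp only [writtenInExtChartAt, extChartAt, Function.comp, mfld_simps]
  have hne : Nonempty U := ⟨p⟩
  have := (OpenPartialHomeomorph.refl W).subtypeRestr_symm_eqOn (U := U) hne
  exact (this (x := y) (by simpa [OpenPartialHomeomorph.subtypeRestr] using hy)).symm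

theorem contDiffAt_of_contMDiffAt {Φ : U → U} {F : W → W} (h : ∀ p : U, (Φ p : W) = F p) {p : U}
    (hΦ : ContMDiffAt 𝓘(ℝ, W) 𝓘(ℝ, W) ∞ Φ p) : ContDiffAt ℝ ∞ F p := by
  rw [← contMDiffAt_iff_contDiffAt, ← contMDiffAt_subtype_iff]
  have := (ContMDiffAt.subtypeVal_comp_iff U Φ p).2 hΦ
  have e : Subtype.val ∘ Φ = fun x : U => F x := funext h
  rwa [e] at this

theorem mfderiv_opens_eq_fderiv {Φ : U → U} {F : W → W} (h : ∀ p : U, (Φ p : W) = F p) {p : U}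
    (hΦ : ContMDiffAt 𝓘(ℝ, W) 𝓘(ℝ, W) ∞ Φ p) (v : W) :
    (mfderiv 𝓘(ℝ, W) 𝓘(ℝ, W) Φ p v : W) = fderiv ℝ F p v := by
  have h1 := (hasMFDerivAt_subtype_val (Φ p)).comp p
    (hΦ.mdifferentiableAt (by simp)).hasMFDerivAt
  have h2 := HasMFDerivAt.comp p (g := F) ((contDiffAt_of_contMDiffAt h hΦ).differentiableAt
    (by simp)).hasFDerivAt.hasMFDerivAt (hasMFDerivAt_subtype_val p)
  have e : Subtype.val ∘ Φ = F ∘ Subtype.val := funext h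
  rw [e] at h1
  exact DFunLike.congr_fun (hasMFDerivAt_unique h1 h2) v

end OpenSubset

/-! ### Differential equations for the components of a web symmetry -/

section WebFun

open Filter Function

variable {n : ℕ} {U : Opens (TX n)} {f : (Fin n → ℝ) → Fin n → ℝ}

/-- The map `(t, x) ↦ (φ₀ t, φ₁ x₁, …, φₙ xₙ)`. -/
def webFun (φ₀ : ℝ → ℝ) (φ : Fin n → ℝ → ℝ) (p : TX n) : TX n := (φ₀ p.1, fun i => φ i (p.2 i))

variable {φ₀ : ℝ → ℝ} {φ : Fin n → ℝ → ℝ}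

theorem differentiableAt_fst_of_webFun {p : TX n} (h : DifferentiableAt ℝ (webFun φ₀ φ) p) :
    DifferentiableAt ℝ φ₀ p.1 := by
  have h1 : DifferentiableAt ℝ (fun t : ℝ => (webFun φ₀ φ (t, p.2)).1) p.1 :=
    (DifferentiableAt.comp (f := fun t : ℝ => (t, p.2)) p.1 h (by fun_prop)).fst
  exact h1

theorem differentiableAt_snd_of_webFun {p : TX n} (h : DifferentiableAt ℝ (webFun φ₀ φ) p)
    (i : Fin n) : DifferentiableAt ℝ (φ i) (p.2 i) := by
  have e : (p.1, update p.2 i (p.2 i)) = p := by simp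
  have h1 : DifferentiableAt ℝ (fun u : ℝ => (webFun φ₀ φ (p.1, update p.2 i u)).2) (p.2 i) := by
    refine (DifferentiableAt.comp (f := fun u : ℝ => (p.1, update p.2 i u)) (p.2 i)
      (by rwa [e]) ?_).snd
    exact (differentiableAt_const _).prodMk (hasDerivAt_update p.2 i (p.2 i)).differentiableAt
  have h2 := differentiableAt_pi.1 h1 i
  simpa [webFun] using h2

theorem fderiv_webFun {p : TX n} (h : DifferentiableAt ℝ (webFun φ₀ φ) p) (v : TX n) :
    fderiv ℝ (webFun φ₀ φ) p v = (deriv φ₀ p.1 * v.1, fun i => deriv (φ i) (p.2 i) * v.2 i) := by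
  have h0 : HasFDerivAt (fun p : TX n => φ₀ p.1)
      (deriv φ₀ p.1 • ContinuousLinearMap.fst ℝ ℝ (Fin n → ℝ)) p :=
    (differentiableAt_fst_of_webFun h).hasDerivAt.comp_hasFDerivAt p hasFDerivAt_fst
  have hi : ∀ i, HasFDerivAt (fun p : TX n => φ i (p.2 i)) (deriv (φ i) (p.2 i) •
      (ContinuousLinearMap.proj i).comp (ContinuousLinearMap.snd ℝ ℝ (Fin n → ℝ))) p := fun i =>
    (differentiableAt_snd_of_webFun h i).hasDerivAt.comp_hasFDerivAt p
      (((ContinuousLinearMap.proj (R := ℝ) (φ := fun _ : Fin n => ℝ) i).hasFDerivAt).comp p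
        hasFDerivAt_snd)
  have := (h0.prodMk (hasFDerivAt_pi.2 hi)).fderiv
  have e : webFun φ₀ φ = fun p : TX n => (φ₀ p.1, fun i => φ i (p.2 i)) := rfl
  rw [e, this]
  ext <;> simp

theorem IsWebMap.exists_eq_webFun {Φ : U → U} (h : IsWebMap Φ) :
    ∃ (φ₀ : ℝ → ℝ) (φ : Fin n → ℝ → ℝ), ∀ p : U, (Φ p : TX n) = webFun φ₀ φ p := h

variable {Φ : U ≃ₜ U}

/-- The components of a web diffeomorphism have nonzero derivatives. -/
theorem deriv_ne_zero_of_web (hΦ : ContMDiff 𝓘(ℝ, TX n) 𝓘(ℝ, TX n) ∞ Φ)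
    (hΦ' : ContMDiff 𝓘(ℝ, TX n) 𝓘(ℝ, TX n) ∞ Φ.symm) (hw : ∀ p : U, (Φ p : TX n) = webFun φ₀ φ p)
    (hw' : IsWebMap Φ.symm) (p : U) :
    deriv φ₀ p.1.1 ≠ 0 ∧ ∀ i, deriv (φ i) (p.1.2 i) ≠ 0 := by
  obtain ⟨ψ₀, ψ, hψ⟩ := hw'.exists_eq_webFun
  have d1 := (contDiffAt_of_contMDiffAt hw (hΦ p)).differentiableAt (by simp)
  have d2 := (contDiffAt_of_contMDiffAt hψ (hΦ' (Φ p))).differentiableAt (by simp)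
  rw [hw p] at d2
  have hcomp := fderiv_comp (p : TX n) d2 d1
  have hid : webFun ψ₀ ψ ∘ webFun φ₀ φ =ᶠ[𝓝 (p : TX n)] id := by
    filter_upwards [U.isOpen.mem_nhds p.2] with y hy
    have e1 := hw ⟨y, hy⟩
    have e2 := hψ (Φ ⟨y, hy⟩)
    rw [Homeomorph.symm_apply_apply, e1] at e2
    exact e2.symm
  rw [hid.fderiv_eq, fderiv_id] at hcomp
  have key : ∀ v : TX n, v = fderiv ℝ (webFun ψ₀ ψ) (webFun φ₀ φ p)
      (fderiv ℝ (webFun φ₀ φ) p v) := fun v => DFunLike.congr_fun hcomp v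
  simp only [fderiv_webFun d1, fderiv_webFun d2] at key
  constructor
  · intro h0
    have := congrArg Prod.fst (key (1, 0))
    simp [h0] at this
  · intro i h0
    have := congrFun (congrArg Prod.snd (key (0, Pi.single i 1))) i
    simp [h0] at this

theorem contactForm_apply (i : Fin n) (p v : TX n) :
    contactForm f i p v = v.2 i - f p.2 i * v.1 := by
  simp [contactForm]

/-- Evaluation on `(1, f)`, which all the forms annihilate, eliminates the matrix `a`. -/
theorem IsWebSymmetry.deriv_mul_eq (h : IsWebSymmetry f Φ)
    (hw : ∀ p : U, (Φ p : TX n) = webFun φ₀ φ p) (p : U) (i : Fin n) :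
    deriv (φ i) (p.1.2 i) * f p.1.2 i = deriv φ₀ p.1.1 * f (Φ p).1.2 i := by
  obtain ⟨a, -, -, ha⟩ := h.preserves
  have d1 := (contDiffAt_of_contMDiffAt hw (h.smooth p)).differentiableAt (by simp)
  have h1 := ha p i (1, f p.1.2)
  have h2 : contactForm f i (Φ p) (fderiv ℝ (webFun φ₀ φ) p (1, f p.1.2)) =
      ∑ j, a p i j * contactForm f j p (1, f p.1.2) := by
    rw [← mfderiv_opens_eq_fderiv hw (h.smooth p)]
    exact h1
  rw [fderiv_webFun d1] at h2
  simp only [contactForm_apply, mul_one, sub_self, mul_zero, Finset.sum_const_zero] at h2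
  linarith

/-- A web diffeomorphism is a symmetry if it maps the direction field of the system to itself. -/
theorem isWebSymmetry_of_deriv_mul_eq (hΦ : ContMDiff 𝓘(ℝ, TX n) 𝓘(ℝ, TX n) ∞ Φ)
    (hΦ' : ContMDiff 𝓘(ℝ, TX n) 𝓘(ℝ, TX n) ∞ Φ.symm) (hw : ∀ p : U, (Φ p : TX n) = webFun φ₀ φ p)
    (hw' : IsWebMap Φ.symm)
    (h : ∀ (p : U) i, deriv (φ i) (p.1.2 i) * f p.1.2 i = deriv φ₀ p.1.1 * f (Φ p).1.2 i) :
    IsWebSymmetry f Φ := by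
  -- The assumed equation says that `φ_i' dx_i - f_i(Φ) φ₀' dt = φ_i' (dx_i - f_i dt)`, so the
  -- matrix is diagonal.
  refine ⟨hΦ, hΦ', ⟨φ₀, φ, hw⟩, hw',
    fun p => Matrix.diagonal fun i => deriv (φ i) (p.1.2 i), fun i j => ?_, fun p => ?_,
    fun p i v => ?_⟩
  · by_cases hij : i = j
    · subst hij
      intro p
      have hs := contDiffAt_of_contMDiffAt hw (hΦ p)
      have h1 : ContDiffAt ℝ ∞
          (fun x => (fderiv ℝ (webFun φ₀ φ) x (0, Pi.single i 1)).2 i) (p : TX n) := by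
        have h2 : ContDiffAt ℝ ∞ (fun x => fderiv ℝ (webFun φ₀ φ) x (0, Pi.single i 1))
          (p : TX n) := (hs.fderiv_right (m := ∞) (by simp)).clm_apply contDiffAt_const
        exact contDiffAt_pi.1 h2.snd i
      refine (contMDiffAt_subtype_iff.2 h1.contMDiffAt).congr_of_eventuallyEq ?_
      refine Eventually.of_forall fun q => ?_
      have d1 := (contDiffAt_of_contMDiffAt hw (hΦ q)).differentiableAt (by simp)
      simp [fderiv_webFun d1]
    · simp only [Matrix.diagonal_apply_ne _ hij]
      exact contMDiff_const
  · rw [Matrix.det_diagonal]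
    exact (Finset.prod_ne_zero_iff.2 fun i _ =>
      (deriv_ne_zero_of_web hΦ hΦ' hw hw' p).2 i).isUnit
  · have d1 := (contDiffAt_of_contMDiffAt hw (hΦ p)).differentiableAt (by simp)
    have h2 : contactForm f i (Φ p) (fderiv ℝ (webFun φ₀ φ) p v) =
        ∑ j, Matrix.diagonal (fun i => deriv (φ i) (p.1.2 i)) i j * contactForm f j p v := by
      rw [fderiv_webFun d1]
      simp only [contactForm_apply, Matrix.diagonal_apply, ite_mul, zero_mul, Finset.sum_ite_eq,
        Finset.mem_univ, if_true]
      linear_combination v.1 * h p i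
    rw [← mfderiv_opens_eq_fderiv hw (hΦ p)] at h2
    exact h2

theorem ell_eq {x : Fin n → ℝ} {i : Fin n} (j : Fin n) (hf : DifferentiableAt ℝ f x)
    (h0 : f x i ≠ 0) :
    ell f i j x = f x j * ((f x i)⁻¹ * fderiv ℝ (fun y => f y i) x (Pi.single j 1)) := by
  have hd : DifferentiableAt ℝ (fun y => f y i) x := differentiableAt_pi.1 hf i
  simp only [ell, Real.log_abs]
  rw [(hd.hasFDerivAt.log h0).fderiv]
  simp

theorem hasDerivAt_comp_update {g : (Fin n → ℝ) → ℝ} {x : Fin n → ℝ} (hg : DifferentiableAt ℝ g x)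
    (j : Fin n) {ψ : ℝ → ℝ} {d u : ℝ} (hψ : HasDerivAt ψ d u) (hu : ψ u = x j) :
    HasDerivAt (fun u => g (update x j (ψ u))) (fderiv ℝ g x (Pi.single j 1) * d) u := by
  have e : update x j (ψ u) = x := by rw [hu]; simp
  have h1 : HasDerivAt (fun s => g (update x j s)) (fderiv ℝ g x (Pi.single j 1)) (ψ u) := by
    refine HasFDerivAt.comp_hasDerivAt (f := update x j) (ψ u) ?_ (hasDerivAt_update x j (ψ u))
    rw [e]; exact hg.hasFDerivAt
  exact h1.comp u hψ

/-- In `φ_i' f_i = φ₀' f_i(Φ)` the factors `φ_i'` and `φ₀'` do not depend on `x_j`. Differentiating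
in `x_j`, dividing by the equation, and replacing `φ_j' f_j` by `φ₀' f_j(Φ)` gives the claim. -/
theorem IsWebSymmetry.deriv_mul_ell (h : IsWebSymmetry f Φ)
    (hw : ∀ p : U, (Φ p : TX n) = webFun φ₀ φ p)
    (hf : ∀ p ∈ U, DifferentiableAt ℝ f p.2) (hf0 : ∀ p ∈ U, ∀ i, f p.2 i ≠ 0) {i j : Fin n}
    (hij : i ≠ j) (p : U) :
    deriv φ₀ p.1.1 * ell f i j (Φ p).1.2 = ell f i j p.1.2 := by
  have d1 := (contDiffAt_of_contMDiffAt hw (h.smooth p)).differentiableAt (by simp)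
  have hp := hf p p.2
  have hq := hf (Φ p) (Φ p).2
  rw [ell_eq j hp (hf0 p p.2 i), ell_eq j hq (hf0 (Φ p) (Φ p).2 i)]
  have hc := (deriv_ne_zero_of_web h.smooth h.smooth_symm hw h.web_symm p).1
  have hΦp : ∀ k, (Φ p).1.2 k = φ k (p.1.2 k) := fun k => by rw [hw p]; rfl
  have hev : ∀ᶠ u in 𝓝 (p.1.2 j), deriv (φ i) (p.1.2 i) * f (update p.1.2 j u) i =
      deriv φ₀ p.1.1 * f (update (Φ p).1.2 j (φ j u)) i := by
    have hcont : Tendsto (fun u => (p.1.1, update p.1.2 j u)) (𝓝 (p.1.2 j)) (𝓝 p.1) :=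
      Continuous.tendsto' (by fun_prop) _ _ (by simp)
    filter_upwards [hcont.eventually (U.isOpen.mem_nhds p.2)] with u hu
    have h1 := h.deriv_mul_eq hw ⟨_, hu⟩ i
    have h2 : (Φ ⟨_, hu⟩).1.2 = update (Φ p).1.2 j (φ j u) := by
      rw [hw]
      ext k
      by_cases hk : k = j
      · subst hk; simp [webFun]
      · simp [webFun, hk, hΦp]
    rw [h2] at h1
    simpa [hij] using h1
  have hfi : ∀ x, DifferentiableAt ℝ f x → DifferentiableAt ℝ (fun y => f y i) x :=
    fun x hx => differentiableAt_pi.1 hx i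
  have e1 := ((hasDerivAt_comp_update (hfi _ hp) j (hasDerivAt_id (p.1.2 j)) rfl).const_mul
    (deriv (φ i) (p.1.2 i)))
  have e2 := ((hasDerivAt_comp_update (hfi _ hq) j
    (differentiableAt_snd_of_webFun d1 j).hasDerivAt (hΦp j).symm).const_mul (deriv φ₀ p.1.1))
  have e3 := e1.unique (e2.congr_of_eventuallyEq hev)
  have hi := h.deriv_mul_eq hw p i
  have hj := h.deriv_mul_eq hw p j
  have n1 := hf0 p p.2 i
  have n2 := hf0 (Φ p) (Φ p).2 i
  set A := fderiv ℝ (fun y => f y i) p.1.2 (Pi.single j 1)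
  set B := fderiv ℝ (fun y => f y i) (Φ p).1.2 (Pi.single j 1)
  set c := deriv φ₀ p.1.1
  field_simp
  apply mul_left_cancel₀ hc
  linear_combination (f p.1.2 i * B) * (-c) * hj + (f p.1.2 i * f p.1.2 j) * (-e3) +
    A * f p.1.2 j * hi

end WebFun

/-! ### The local formula for web symmetries -/

section

open Filter Function

/-- A solution of the separable equation `ψ' = c A(ψ) B(u)` is controlled near `ψ u₀` and given
there by primitives of `1 / A` and `B`. -/
theorem primitive_eq_of_separable {ψ A B Fa Fq : ℝ → ℝ} {c u₀ u₁ η M₁ M₂ M₃ : ℝ}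
    (hψ : ∀ u ∈ uIcc u₀ u₁, HasDerivAt ψ (c * A (ψ u) * B u) u)
    (hA : ∀ s, |s - ψ u₀| ≤ η → |A s| ≤ M₁ ∧ A s ≠ 0 ∧ HasDerivAt Fa (A s)⁻¹ s)
    (hB : ∀ u ∈ uIcc u₀ u₁, |B u| ≤ M₂ ∧ HasDerivAt Fq (B u) u)
    (hc : |c| ≤ M₃) (hη : 0 < η) (hM : M₃ * M₁ * M₂ * |u₁ - u₀| < η) (h0 : Fa (ψ u₀) = 0)
    (h0' : Fq u₀ = 0) : |ψ u₁ - ψ u₀| ≤ η ∧ Fa (ψ u₁) = c * Fq u₁ := by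
  set p : ℝ → ℝ := fun θ => u₀ + θ * (u₁ - u₀) with hp
  have hp0 : p 0 = u₀ := by simp [hp]
  have hp1 : p 1 = u₁ := by simp [hp]
  have hmem : ∀ θ ∈ Icc (0 : ℝ) 1, p θ ∈ uIcc u₀ u₁ := by
    intro θ hθ
    rw [← segment_eq_uIcc, segment_eq_image']
    exact ⟨θ, hθ, by simp [hp]⟩
  have hpd : ∀ θ, HasDerivAt p (u₁ - u₀) θ := fun θ => by
    have := ((hasDerivAt_id θ).mul_const (u₁ - u₀)).const_add u₀
    rwa [one_mul] at this
  have hψp : ∀ θ ∈ Icc (0 : ℝ) 1,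
      HasDerivAt (fun θ => ψ (p θ)) (c * A (ψ (p θ)) * B (p θ) * (u₁ - u₀)) θ :=
    fun θ hθ => (hψ _ (hmem θ hθ)).comp θ (hpd θ)
  -- The bound on `A` is available only within `η` of `ψ u₀`, so a barrier is needed: wherever `|ψ -
  -- ψ u₀|` meets the line `η θ`, its speed is below `η`.
  have hbound : ∀ θ ∈ Icc (0 : ℝ) 1, |ψ (p θ) - ψ u₀| ≤ η * θ := by
    have := image_norm_le_of_norm_deriv_right_lt_deriv_boundary'
      (f := fun θ => ψ (p θ) - ψ u₀) (a := 0) (b := 1) (B := fun θ => η * θ) (B' := fun _ => η)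
      (fun θ hθ => ((hψp θ hθ).sub_const _).continuousAt.continuousWithinAt)
      (fun θ hθ => ((hψp θ (Ico_subset_Icc_self hθ)).sub_const _).hasDerivWithinAt)
      (by simp [hp0]) (by fun_prop)
      (fun θ _ => by simpa using ((hasDerivAt_id θ).const_mul η).hasDerivWithinAt)
      (fun θ hθ hθe => ?_)
    · intro θ hθ; exact this hθ
    · rw [Real.norm_eq_abs] at hθe ⊢
      have h1 : |ψ (p θ) - ψ u₀| ≤ η := by rw [hθe]; nlinarith [hθ.2]
      refine lt_of_le_of_lt ?_ hM
      rw [abs_mul, abs_mul, abs_mul]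
      have h2 := (hA _ h1).1
      have h3 := (hB _ (hmem θ (Ico_subset_Icc_self hθ))).1
      have h4 := abs_nonneg c
      have h5 := abs_nonneg (A (ψ (p θ)))
      have h6 := abs_nonneg (B (p θ))
      have h7 := h4.trans hc
      have h8 := h5.trans h2
      gcongr
  have hle : ∀ θ ∈ Icc (0 : ℝ) 1, |ψ (p θ) - ψ u₀| ≤ η := fun θ hθ =>
    (hbound θ hθ).trans (by nlinarith [hθ.2])
  have hder : ∀ θ ∈ Icc (0 : ℝ) 1,
      HasDerivAt (fun θ => Fa (ψ (p θ)) - c * Fq (p θ)) 0 θ := by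
    intro θ hθ
    obtain ⟨-, hA0, hFa⟩ := hA _ (hle θ hθ)
    have h1 := hFa.comp θ (hψp θ hθ)
    have h2 := ((hB _ (hmem θ hθ)).2.comp θ (hpd θ)).const_mul c
    have h3 : (A (ψ (p θ)))⁻¹ * (c * A (ψ (p θ)) * B (p θ) * (u₁ - u₀)) -
        c * (B (p θ) * (u₁ - u₀)) = 0 := by
      field_simp
      ring
    rw [← h3]
    exact h1.sub h2
  have hconst := constant_of_has_deriv_right_zero
    (fun θ hθ => (hder θ hθ).continuousAt.continuousWithinAt)
    (fun θ hθ => (hder θ (Ico_subset_Icc_self hθ)).hasDerivWithinAt) 1 (by simp)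
  refine ⟨by simpa [hp1] using hle 1 (by simp), ?_⟩
  simp only [hp0, hp1, h0, h0'] at hconst
  linarith

end

section LocalFormula

open Filter Function

variable {n : ℕ} {U : Opens (TX n)} {f : (Fin n → ℝ) → Fin n → ℝ}

theorem contDiffAt_of_mem (hf : ContDiffOn ℝ ∞ f (Prod.snd '' (U : Set (TX n)))) {p : TX n}
    (hp : p ∈ U) : ContDiffAt ℝ ∞ f p.2 :=
  hf.contDiffAt ((isOpenMap_snd _ U.isOpen).mem_nhds ⟨p, hp, rfl⟩)

theorem contDiffAt_ell (hf : ContDiffOn ℝ ∞ f (Prod.snd '' (U : Set (TX n))))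
    (hf0 : ∀ p ∈ U, ∀ i, f p.2 i ≠ 0) (i j : Fin n) {p : TX n} (hp : p ∈ U) :
    ContDiffAt ℝ ∞ (ell f i j) p.2 := by
  have h1 := contDiffAt_pi.1 (contDiffAt_of_mem hf hp)
  have h2 : ContDiffAt ℝ ∞ (fun y => Real.log |f y i|) p.2 := by
    simp only [Real.log_abs]
    exact (h1 i).log (hf0 p hp i)
  exact (h1 j).mul ((h2.fderiv_right (m := ∞) (by simp)).clm_apply contDiffAt_const)

theorem mk_mem_ball {c : TX n} {r t : ℝ} {x : Fin n → ℝ} (ht : t ∈ Metric.ball c.1 r)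
    (hx : x ∈ Metric.ball c.2 r) : (t, x) ∈ Metric.ball c r := by
  have : Metric.ball c r = Metric.ball c.1 r ×ˢ Metric.ball c.2 r := (ball_prod_same _ _ _).symm
  rw [this]
  exact ⟨ht, hx⟩

theorem fst_mem_ball {c p : TX n} {r : ℝ} (h : p ∈ Metric.ball c r) :
    p.1 ∈ Metric.ball c.1 r := by
  have : Metric.ball c r = Metric.ball c.1 r ×ˢ Metric.ball c.2 r := (ball_prod_same _ _ _).symm
  rw [this] at h
  exact h.1

theorem snd_mem_ball {c p : TX n} {r : ℝ} (h : p ∈ Metric.ball c r) :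
    p.2 ∈ Metric.ball c.2 r := by
  have : Metric.ball c r = Metric.ball c.1 r ×ˢ Metric.ball c.2 r := (ball_prod_same _ _ _).symm
  rw [this] at h
  exact h.2

theorem apply_mem_ball {x c : Fin n → ℝ} {r : ℝ} (h : x ∈ Metric.ball c r) (i : Fin n) :
    x i ∈ Metric.ball (c i) r := by
  rw [Metric.mem_ball] at h ⊢
  exact (dist_le_pi_dist x c i).trans_lt h

variable {φ₀ : ℝ → ℝ} {φ : Fin n → ℝ → ℝ} {Φ : U ≃ₜ U}

/-- The first component of a web symmetry is affine with slope given by `ell`. -/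
theorem IsWebSymmetry.fst_apply (h : IsWebSymmetry f Φ)
    (hf : ContDiffOn ℝ ∞ f (Prod.snd '' (U : Set (TX n)))) (hf0 : ∀ p ∈ U, ∀ i, f p.2 i ≠ 0)
    {i j : Fin n} (hij : i ≠ j) (hell : ∀ p ∈ U, ell f i j p.2 ≠ 0) {c : TX n} {r : ℝ}
    (hr : Metric.ball c r ⊆ U) {x y : U} (hx : (x : TX n) ∈ Metric.ball c r)
    (hy : (y : TX n) ∈ Metric.ball c r) :
    (Φ y).1.1 = (Φ x).1.1 + ell f i j x.1.2 / ell f i j (Φ x).1.2 * (y.1.1 - x.1.1) := by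
  obtain ⟨φ₀, φ, hw⟩ := h.web.exists_eq_webFun
  set k := ell f i j x.1.2 / ell f i j (Φ x).1.2 with hk
  have hder : ∀ t ∈ Metric.ball c.1 r, HasDerivAt φ₀ k t := by
    intro t ht
    have hp : (t, x.1.2) ∈ U := hr (mk_mem_ball ht (snd_mem_ball hx))
    have d1 := (contDiffAt_of_contMDiffAt hw (h.smooth ⟨_, hp⟩)).differentiableAt (by simp)
    have h1 := (differentiableAt_fst_of_webFun d1).hasDerivAt
    have h2 := h.deriv_mul_ell hw (fun p hp => (contDiffAt_of_mem hf hp).differentiableAt (by simp))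
      hf0 hij ⟨_, hp⟩
    -- Changing `t` does not move the image of the `x`-coordinates, so the slope is the same for all
    -- `t` in the interval.
    have h3 : (Φ ⟨_, hp⟩).1.2 = (Φ x).1.2 := by rw [hw, hw x]; rfl
    rw [h3] at h2
    rwa [eq_div_of_mul_eq (hell _ (Φ x).2) h2] at h1
  have h4 := (convex_ball c.1 r).norm_image_sub_le_of_norm_hasDerivWithin_le
    (f := fun t => φ₀ t - k * t) (f' := fun _ => 0) (C := 0)
    (fun t ht => by
      have := ((hder t ht).sub ((hasDerivAt_id t).const_mul k)).hasDerivWithinAt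
        (s := Metric.ball c.1 r)
      rw [mul_one, sub_self] at this
      exact this)
    (fun _ _ => by simp) (fst_mem_ball hx) (fst_mem_ball hy)
  have h5 : φ₀ y.1.1 - k * y.1.1 - (φ₀ x.1.1 - k * x.1.1) = 0 := by
    simpa using h4
  have e1 : (Φ y).1.1 = φ₀ y.1.1 := by rw [hw]; rfl
  have e2 : (Φ x).1.1 = φ₀ x.1.1 := by rw [hw]; rfl
  rw [e1, e2]
  linarith

/-- The further components of a web symmetry solve a separable equation. -/
theorem IsWebSymmetry.hasDerivAt_snd (h : IsWebSymmetry f Φ)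
    (hw : ∀ p : U, (Φ p : TX n) = webFun φ₀ φ p)
    (hf : ContDiffOn ℝ ∞ f (Prod.snd '' (U : Set (TX n)))) (hf0 : ∀ p ∈ U, ∀ i, f p.2 i ≠ 0)
    {i j : Fin n} (hij : i ≠ j) (hell : ∀ p ∈ U, ell f i j p.2 ≠ 0) {x : U} {u : ℝ} {k : Fin n}
    (hu : (x.1.1, update x.1.2 k u) ∈ U) :
    f (update (Φ x).1.2 k (φ k u)) k ≠ 0 ∧
    HasDerivAt (φ k) (ell f i j x.1.2 / ell f i j (Φ x).1.2 *
      f (update (Φ x).1.2 k (φ k u)) k * (f (update x.1.2 k u) k)⁻¹) u := by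
  have d1 := (contDiffAt_of_contMDiffAt hw (h.smooth ⟨_, hu⟩)).differentiableAt (by simp)
  have h1 := (differentiableAt_snd_of_webFun d1 k).hasDerivAt
  have h2 := h.deriv_mul_ell hw (fun p hp => (contDiffAt_of_mem hf hp).differentiableAt (by simp))
      hf0 hij x
  have h3 := h.deriv_mul_eq hw ⟨_, hu⟩ k
  have h4 : (Φ ⟨_, hu⟩).1.2 = update (Φ x).1.2 k (φ k u) := by
    rw [hw, hw x]
    ext l
    by_cases hl : l = k
    · subst hl; simp [webFun]
    · simp [webFun, hl]
  have h5 := hf0 _ (Φ ⟨_, hu⟩).2 k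
  have h6 := hf0 _ hu k
  rw [h4] at h3 h5
  simp only [update_self] at h1 h3
  refine ⟨h5, ?_⟩
  rw [← eq_div_of_mul_eq (hell _ (Φ x).2) h2, ← h3]
  rwa [mul_inv_cancel_right₀ h6]

theorem hasLocalFormula_webSymmetry (hf : ContDiffOn ℝ ∞ f (Prod.snd '' (U : Set (TX n))))
    (hf0 : ∀ p ∈ U, ∀ i, f p.2 i ≠ 0) {i₀ j₀ : Fin n} (hij : i₀ ≠ j₀)
    (hell : ∀ p ∈ U, ell f i₀ j₀ p.2 ≠ 0) : HasLocalFormula (webSymmetrySubgroup f U) := by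
  refine ⟨fun q b => ?_⟩
  obtain ⟨r, hr, hrq, hrb⟩ : ∃ r > 0, Metric.ball (q : TX n) r ⊆ U ∧
      Metric.ball (b : TX n) r ⊆ U := by
    obtain ⟨r₁, h₁, h₁'⟩ := Metric.isOpen_iff.1 U.isOpen q q.2
    obtain ⟨r₂, h₂, h₂'⟩ := Metric.isOpen_iff.1 U.isOpen b b.2
    exact ⟨min r₁ r₂, by positivity,
      (Metric.ball_subset_ball (min_le_left _ _)).trans h₁',
      (Metric.ball_subset_ball (min_le_right _ _)).trans h₂'⟩
  have hball : ∀ c : TX n, Metric.ball c r ⊆ U → ∀ y ∈ Metric.ball c.2 r, (c.1, y) ∈ U :=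
    fun c hc y hy => hc (mk_mem_ball (Metric.mem_ball_self hr) hy)
  have hinv : ∀ c : TX n, Metric.ball c r ⊆ U → ∀ i,
      ContDiffOn ℝ ∞ (fun y => (f y i)⁻¹) (Metric.ball c.2 r) := fun c hc i y hy =>
    ((contDiffAt_pi.1 (contDiffAt_of_mem hf (hball c hc y hy)) i).inv
      (hf0 _ (hball c hc y hy) i)).contDiffWithinAt
  choose S hSs hS0 hSeq using fun i => exists_lineIntegral_solution hr (hinv b hrb i)
    (fun y hy => inv_ne_zero (hf0 _ (hball b hrb y hy) i)) i
  set κ : TX n × TX n × TX n → ℝ := fun z => ell f i₀ j₀ z.1.2 / ell f i₀ j₀ z.2.1.2 with hκ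
  -- For `z = (x, g x, y)`, the separable equation says that the integral of `1 / f_i` from `g x` to
  -- `φ_i (y_i)` equals `κ` times the one from `x_i` to `y_i`; `S i` solves this for `φ_i (y_i)`.
  set τ : Fin n → TX n × TX n × TX n → (Fin n → ℝ) × ℝ := fun i z =>
    (z.2.1.2, κ z * lineIntegral (fun y => (f y i)⁻¹) i (z.1.2, z.2.2.2 i)) with hτ
  set z₀ : TX n × TX n × TX n := ((q : TX n), (b : TX n), (q : TX n)) with hz₀
  have hnear : ∀ᶠ z in 𝓝 z₀, z.1 ∈ Metric.ball (q : TX n) r ∧ z.2.1 ∈ Metric.ball (b : TX n) r ∧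
      z.2.2 ∈ Metric.ball (q : TX n) r :=
    (prod_mem_nhds (Metric.ball_mem_nhds _ hr)
      (prod_mem_nhds (Metric.ball_mem_nhds _ hr) (Metric.ball_mem_nhds _ hr)))
  have hκs : ∀ z : TX n × TX n × TX n, z.1 ∈ Metric.ball (q : TX n) r →
      z.2.1 ∈ Metric.ball (b : TX n) r → ContDiffAt ℝ ∞ κ z := by
    intro z h1 h2
    refine ContDiffAt.div ?_ ?_ (hell _ (hrb h2))
    · exact (contDiffAt_ell hf hf0 i₀ j₀ (hrq h1)).comp
        (f := fun z : TX n × TX n × TX n => z.1.2) z (by fun_prop)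
    · exact (contDiffAt_ell hf hf0 i₀ j₀ (hrb h2)).comp
        (f := fun z : TX n × TX n × TX n => z.2.1.2) z (by fun_prop)
  have hτs : ∀ i, ∀ z : TX n × TX n × TX n, z.1 ∈ Metric.ball (q : TX n) r →
      z.2.1 ∈ Metric.ball (b : TX n) r → z.2.2 ∈ Metric.ball (q : TX n) r →
      ContDiffAt ℝ ∞ (τ i) z := by
    intro i z h1 h2 h3
    refine ContDiffAt.prodMk (by fun_prop) ((hκs z h1 h2).mul ?_)
    exact (contDiffAt_lineIntegral (hinv q hrq i) i
      (z := (z.1.2, z.2.2.2 i)) ⟨snd_mem_ball h1, apply_mem_ball (snd_mem_ball h3) i⟩).comp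
        (f := fun z : TX n × TX n × TX n => (z.1.2, z.2.2.2 i)) z (by fun_prop)
  have hτ0 : ∀ i, τ i z₀ = (b.1.2, 0) := fun i => by
    simp [hτ, hz₀, lineIntegral_self]
  refine ⟨fun z => (z.2.1.1 + κ z * (z.2.2.1 - z.1.1), fun i => S i (τ i z)), ?_, ?_, ?_⟩
  · have hev : ∀ᶠ z in 𝓝 z₀, ∀ i, ContDiffAt ℝ ∞ (S i) (τ i z) := by
      rw [eventually_all]
      intro i
      have hc := (hτs i z₀ (Metric.mem_ball_self hr) (Metric.mem_ball_self hr)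
        (Metric.mem_ball_self hr)).continuousAt.tendsto
      rw [hτ0] at hc
      exact hc.eventually (hSs i)
    filter_upwards [hnear, hev] with z ⟨h1, h2, h3⟩ h4
    refine ContDiffAt.prodMk (ContDiffAt.add (by fun_prop)
      ((hκs z h1 h2).mul (by fun_prop))) (contDiffAt_pi.2 fun i => ?_)
    exact (h4 i).comp z (hτs i z h1 h2 h3)
  · have : ∀ i, S i (τ i z₀) = b.1.2 i := fun i => by rw [hτ0, hS0]
    ext
    · simp [hz₀]
    · exact this _
  · have hcoe : Tendsto (fun z : U × U × U => ((z.1 : TX n), (z.2.1 : TX n), (z.2.2 : TX n)))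
        (𝓝 (q, b, q)) (𝓝 z₀) := Continuous.tendsto' (by fun_prop) _ _ rfl
    have hsnd : ∀ i, ∀ᶠ z : U × U × U in 𝓝 (q, b, q), ∀ g ∈ webSymmetrySubgroup f U,
        g z.1 = z.2.1 → (g z.2.2).1.2 i = S i (τ i (z.1, z.2.1, z.2.2)) := by
      intro i
      have hcont : ∀ c ∈ U, ContinuousAt
          (fun w : (Fin n → ℝ) × ℝ => f (update w.1 i w.2) i) (c.2, c.2 i) := by
        intro c hc
        have h1 : ContinuousAt (fun y => f y i) (update c.2 i (c.2 i)) := by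
          rw [update_eq_self]
          exact (contDiffAt_pi.1 (contDiffAt_of_mem hf hc) i).continuousAt
        exact ContinuousAt.comp (f := fun w : (Fin n → ℝ) × ℝ => update w.1 i w.2)
          (x := (c.2, c.2 i)) h1 (by fun_prop)
      -- The three bounds depend only on the base points, so one neighbourhood serves all symmetries
      -- `g` at once, as the formula requires.
      set M₁ := |f b.1.2 i| + 1 with hM₁
      set M₂ := |(f q.1.2 i)⁻¹| + 1 with hM₂
      set M₃ := |κ z₀| + 1 with hM₃
      have hA : ∀ᶠ w : (Fin n → ℝ) × ℝ in 𝓝 (b.1.2, b.1.2 i), |f (update w.1 i w.2) i| < M₁ := by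
        refine (hcont b b.2).abs.eventually (gt_mem_nhds ?_)
        simp [hM₁]
      have hQ : ∀ᶠ w : (Fin n → ℝ) × ℝ in 𝓝 (q.1.2, q.1.2 i),
          |(f (update w.1 i w.2) i)⁻¹| < M₂ := by
        have hne : f (update q.1.2 i (q.1.2 i)) i ≠ 0 := by
          rw [update_eq_self]; exact hf0 q q.2 i
        refine ((hcont q q.2).inv₀ hne).abs.eventually (gt_mem_nhds ?_)
        simp [hM₂]
      have hK : ∀ᶠ z in 𝓝 z₀, |κ z| < M₃ :=
        (hκs z₀ (Metric.mem_ball_self hr) (Metric.mem_ball_self hr)).continuousAt.abs.eventually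
          (gt_mem_nhds (by simp [hM₃]))
      obtain ⟨η', hη', hηb⟩ := Metric.eventually_nhds_iff_ball.1 ((hSeq i).and hA)
      obtain ⟨ρ', hρ', hρb⟩ := Metric.eventually_nhds_iff_ball.1 hQ
      set η := min η' r with hη
      set ρ := min ρ' r with hρ
      have hηpos : 0 < η := by positivity
      have hρpos : 0 < ρ := by positivity
      -- One half of `η` is left for the distance of `g x` from `b`, the other for the motion of
      -- `φ_i`.
      have hlen : ∀ᶠ z in 𝓝 z₀, M₃ * M₁ * M₂ * |z.2.2.2 i - z.1.2 i| < η / 2 := by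
        have hc : Continuous fun z : TX n × TX n × TX n =>
            M₃ * M₁ * M₂ * |z.2.2.2 i - z.1.2 i| := by fun_prop
        refine (hc.tendsto z₀).eventually (gt_mem_nhds ?_)
        simpa [hz₀] using hηpos
      have hnear' : ∀ᶠ z in 𝓝 z₀, z.1 ∈ Metric.ball (q : TX n) ρ ∧
          z.2.1 ∈ Metric.ball (b : TX n) (η / 2) ∧ z.2.2 ∈ Metric.ball (q : TX n) ρ :=
        (prod_mem_nhds (Metric.ball_mem_nhds _ hρpos)
          (prod_mem_nhds (Metric.ball_mem_nhds _ (half_pos hηpos))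
            (Metric.ball_mem_nhds _ hρpos)))
      filter_upwards [hcoe.eventually hnear', hcoe.eventually hK, hcoe.eventually hlen]
        with ⟨x, a, y⟩ ⟨h1, h2, h3⟩ h4 h5 g hg' he
      simp only at h1 h2 h3 h4 h5 he ⊢
      subst he
      have hg : IsWebSymmetry f g := hg'
      obtain ⟨φ₀, φ, hw⟩ := hg.web.exists_eq_webFun
      have e1 : ∀ p : U, (g p).1.2 i = φ i (p.1.2 i) := fun p => by rw [hw]; rfl
      have ha : (g x).1.2 ∈ Metric.ball b.1.2 η :=
        Metric.ball_subset_ball (by linarith) (snd_mem_ball h2)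
      have hseg : ∀ u ∈ uIcc (x.1.2 i) (y.1.2 i), u ∈ Metric.ball (q.1.2 i) ρ := by
        intro u hu
        rw [← segment_eq_uIcc] at hu
        exact (convex_ball _ _).segment_subset (apply_mem_ball (snd_mem_ball h1) i)
          (apply_mem_ball (snd_mem_ball h3) i) hu
      have hρr : ∀ {Y : Type} [PseudoMetricSpace Y] (c : Y), Metric.ball c ρ ⊆ Metric.ball c r :=
        fun c => Metric.ball_subset_ball (min_le_right _ _)
      have hηr : ∀ {Y : Type} [PseudoMetricSpace Y] (c : Y), Metric.ball c η ⊆ Metric.ball c r :=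
        fun c => Metric.ball_subset_ball (min_le_right _ _)
      have hs : ∀ s, |s - φ i (x.1.2 i)| ≤ η / 2 → s ∈ Metric.ball (b.1.2 i) η := by
        intro s hs
        have h6 := apply_mem_ball (snd_mem_ball h2) i
        rw [e1 x, Metric.mem_ball, Real.dist_eq] at h6
        rw [Metric.mem_ball, Real.dist_eq]
        have := abs_sub_le s (φ i (x.1.2 i)) (b.1.2 i)
        linarith
      have hwmem : ∀ s, |s - φ i (x.1.2 i)| ≤ η / 2 →
          ((g x).1.2, s) ∈ Metric.ball (b.1.2, b.1.2 i) η' := fun s hs' => by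
        rw [← ball_prod_same]
        exact ⟨Metric.ball_subset_ball (min_le_left _ _) ha,
          Metric.ball_subset_ball (min_le_left _ _) (hs s hs')⟩
      have key := primitive_eq_of_separable (ψ := φ i)
        (A := fun s => f (update (g x).1.2 i s) i) (B := fun u => (f (update x.1.2 i u) i)⁻¹)
        (Fa := fun s => lineIntegral (fun y => (f y i)⁻¹) i ((g x).1.2, s))
        (Fq := fun u => lineIntegral (fun y => (f y i)⁻¹) i (x.1.2, u))
        (c := ell f i₀ j₀ x.1.2 / ell f i₀ j₀ (g x).1.2) (u₀ := x.1.2 i) (u₁ := y.1.2 i)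
        (η := η / 2) (M₁ := M₁) (M₂ := M₂) (M₃ := M₃) ?_ ?_ ?_ h4.le (half_pos hηpos) h5 ?_
        (lineIntegral_self _ _ _)
      · have h7 := (hηb _ (hwmem _ key.1)).1
        simp only at h7
        rw [e1 y, ← h7, key.2]
      · intro u hu
        have hmem : (x.1.1, update x.1.2 i u) ∈ U :=
          hrq (mk_mem_ball (hρr _ (fst_mem_ball h1))
            (update_mem_ball (hρr _ (snd_mem_ball h1)) (hρr _ (hseg u hu))))
        exact (hg.hasDerivAt_snd hw hf hf0 hij hell hmem).2
      · intro s hs'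
        refine ⟨(hηb _ (hwmem s hs')).2.le, ?_, ?_⟩
        · exact hf0 _ (hball b hrb _ (update_mem_ball (hηr _ ha) (hηr _ (hs s hs')))) i
        · exact hasDerivAt_lineIntegral (hinv b hrb i).continuousOn i (hηr _ ha) (hηr _ (hs s hs'))
      · intro u hu
        refine ⟨(hρb (x.1.2, u) ?_).le, ?_⟩
        · rw [← ball_prod_same]
          exact ⟨Metric.ball_subset_ball (min_le_left _ _) (snd_mem_ball h1),
            Metric.ball_subset_ball (min_le_left _ _) (hseg u hu)⟩
        · exact hasDerivAt_lineIntegral (hinv q hrq i).continuousOn i (hρr _ (snd_mem_ball h1))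
            (hρr _ (hseg u hu))
      · rw [← e1 x]
        exact lineIntegral_self _ _ _
    filter_upwards [hcoe.eventually hnear, eventually_all.2 hsnd] with z ⟨h1, h2, h3⟩ h4 g hg he
    have h5 := IsWebSymmetry.fst_apply (f := f) hg hf hf0 hij hell hrq h1 h3
    rw [he] at h5
    ext i
    · exact h5
    · exact h4 i g hg he

end LocalFormula

/-! ### Limits of web symmetries -/

namespace HasLocalFormula

open Filter

variable {W : Type*} [NormedAddCommGroup W] [NormedSpace ℝ W] {U : Opens W}
  {H : Subgroup (U ≃ₜ U)} {ι : Type*} {l : Filter ι} [l.NeBot] {Γ : ι → H} {Φ : U → U}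

/-- The limit and the approximating maps are given near `q` by the same smooth `m`, differing only
in the parameter `g q`. Hence the limit is smooth and derivatives converge, with no compactness
argument. -/
theorem exists_limit_formula (hH : HasLocalFormula H)
    (hΦ : ∀ q, Tendsto (fun i => (Γ i).1 q) l (𝓝 (Φ q))) (q : U) :
    ∃ m : W × W → W, ContDiffAt ℝ ∞ m (Φ q, q) ∧ (∀ᶠ y in 𝓝 q, (Φ y : W) = m (Φ q, y)) ∧
      ∀ᶠ i in l, ContDiffAt ℝ ∞ m ((Γ i).1 q, q) ∧
        ∀ᶠ y in 𝓝 q, ((Γ i).1 y : W) = m ((Γ i).1 q, y) := by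
  obtain ⟨E, hE, -, hform⟩ := hH.exists_formula q (Φ q)
  have hE' : ∀ᶠ z : U × U in 𝓝 (Φ q, q),
      ContDiffAt ℝ ∞ (fun w : W × W => E (q, w.1, w.2)) (z.1, z.2) := by
    have hc : Continuous fun z : U × U => ((q : W), (z.1 : W), (z.2 : W)) := by fun_prop
    filter_upwards [(hc.tendsto (Φ q, q)).eventually hE] with z hz
    exact hz.comp (f := fun w : W × W => ((q : W), w.1, w.2)) ((z.1 : W), (z.2 : W)) (by fun_prop)
  have hform' : ∀ᶠ z : U × U in 𝓝 (Φ q, q), ∀ g ∈ H, g q = z.1 → (g z.2 : W) = E (q, z.1, z.2) := by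
    have hc : Continuous fun z : U × U => (q, z.1, z.2) := by fun_prop
    exact (hc.tendsto (Φ q, q)).eventually hform
  obtain ⟨M, N, hM, hΦM, hN, hqN, hMN⟩ := mem_nhds_prod_iff'.1 (hE'.and hform')
  have hbox : ∀ a ∈ M, ∀ y ∈ N, ContDiffAt ℝ ∞ (fun w : W × W => E (q, w.1, w.2)) ((a : W), (y : W)) ∧
      ∀ g ∈ H, g q = a → (g y : W) = E (q, a, y) := fun a ha y hy =>
    hMN (show (a, y) ∈ M ×ˢ N from ⟨ha, hy⟩)
  have hev : ∀ᶠ i in l, (Γ i).1 q ∈ M := (hΦ q).eventually (hM.mem_nhds hΦM)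
  refine ⟨fun w => E (q, w.1, w.2), (hbox _ hΦM q hqN).1, ?_, ?_⟩
  · filter_upwards [hN.mem_nhds hqN] with y hy
    have h1 : Tendsto (fun i => ((Γ i).1 y : W)) l (𝓝 (Φ y : W)) :=
      (continuous_subtype_val.tendsto _).comp (hΦ y)
    have h2 : Tendsto (fun i => (((Γ i).1 q : W), (y : W))) l (𝓝 ((Φ q : W), (y : W))) :=
      ((continuous_subtype_val.tendsto _).comp (hΦ q)).prodMk_nhds tendsto_const_nhds
    have h3 := (hbox _ hΦM y hy).1.continuousAt.tendsto.comp h2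
    refine tendsto_nhds_unique h1 (h3.congr' ?_)
    filter_upwards [hev] with i hi
    exact ((hbox _ hi y hy).2 _ (Γ i).2 rfl).symm
  · filter_upwards [hev] with i hi
    refine ⟨(hbox _ hi q hqN).1, ?_⟩
    filter_upwards [hN.mem_nhds hqN] with y hy
    exact (hbox _ hi y hy).2 _ (Γ i).2 rfl

theorem contMDiff_limit (hH : HasLocalFormula H)
    (hΦ : ∀ q, Tendsto (fun i => (Γ i).1 q) l (𝓝 (Φ q))) :
    ContMDiff 𝓘(ℝ, W) 𝓘(ℝ, W) ∞ Φ := by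
  intro q
  rw [← ContMDiffAt.subtypeVal_comp_iff]
  obtain ⟨m, hm, hform, -⟩ := hH.exists_limit_formula hΦ q
  have h1 : ContMDiffAt 𝓘(ℝ, W) 𝓘(ℝ, W) ∞ (fun y : W => m (Φ q, y)) q :=
    (hm.comp (f := fun y : W => ((Φ q : W), y)) (q : W) (by fun_prop)).contMDiffAt
  exact (contMDiffAt_subtype_iff.2 h1).congr_of_eventuallyEq hform

theorem tendsto_fderiv_limit (hH : HasLocalFormula H)
    (hΦ : ∀ q, Tendsto (fun i => (Γ i).1 q) l (𝓝 (Φ q))) {F : ι → W → W} {F' : W → W}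
    (hF : ∀ i (p : U), ((Γ i).1 p : W) = F i p) (hF' : ∀ p : U, (Φ p : W) = F' p) (q : U) :
    Tendsto (fun i => fderiv ℝ (F i) q) l (𝓝 (fderiv ℝ F' q)) := by
  obtain ⟨m, hm, hform, hev⟩ := hH.exists_limit_formula hΦ q
  have key : ∀ {G : W → W} {a : W}, ContDiffAt ℝ ∞ m (a, q) →
      (∀ᶠ y : U in 𝓝 q, G y = m (a, y)) → fderiv ℝ G q = RigidGroup.sndDeriv m (a, q) := by
    intro G a ha hG
    refine ((RigidGroup.hasFDerivAt_snd ha).congr_of_eventuallyEq ?_).fderiv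
    have := U.isOpenEmbedding'.map_nhds_eq q
    rw [← this]
    exact eventually_map.2 hG
  rw [key hm (hform.mono fun y hy => by rw [← hF', hy])]
  have h2 : Tendsto (fun i => (((Γ i).1 q : W), (q : W))) l (𝓝 ((Φ q : W), (q : W))) :=
    ((continuous_subtype_val.tendsto _).comp (hΦ q)).prodMk_nhds tendsto_const_nhds
  refine ((RigidGroup.contDiffAt_sndDeriv hm).continuousAt.tendsto.comp h2).congr' ?_
  filter_upwards [hev] with i hi
  exact (key hi.1 (hi.2.mono fun y hy => by rw [← hF, hy])).symm

theorem apply_limit_symm (hH : HasLocalFormula H) {Ψ : U → U}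
    (hΦ : ∀ q, Tendsto (fun i => (Γ i).1 q) l (𝓝 (Φ q)))
    (hΨ : ∀ q, Tendsto (fun i => (Γ i).1.symm q) l (𝓝 (Ψ q))) (q : U) : Φ (Ψ q) = q := by
  have h := hH.tendsto_apply_of_tendsto (hΦ (Ψ q)) (hΨ q)
  simp only [Homeomorph.apply_symm_apply] at h
  exact tendsto_nhds_unique h tendsto_const_nhds

end HasLocalFormula

/-! ### Rigidity of the web symmetry group -/

section WebLimit

open Filter

variable {n : ℕ} {U : Opens (TX n)} {f : (Fin n → ℝ) → Fin n → ℝ}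

/-- This form passes to pointwise limits without any convergence of the functions `φ_i`, whose
values off the projections of `U` are arbitrary. -/
theorem isWebMap_iff {Φ : U → U} : IsWebMap Φ ↔
    (∀ p p' : U, p.1.1 = p'.1.1 → (Φ p).1.1 = (Φ p').1.1) ∧
      ∀ i, ∀ p p' : U, p.1.2 i = p'.1.2 i → (Φ p).1.2 i = (Φ p').1.2 i := by
  constructor
  · rintro ⟨φ₀, φ, h⟩
    exact ⟨fun p p' hp => by simp [h, hp], fun i p p' hp => by simp [h, hp]⟩
  · rintro ⟨h0, h⟩
    have ex : ∀ {k : U → ℝ} {v : U → ℝ}, (∀ p p', k p = k p' → v p = v p') →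
        ∃ φ : ℝ → ℝ, ∀ p, v p = φ (k p) := fun {k v} hkv =>
      ⟨Function.extend k v 0, fun p =>
        ((Function.FactorsThrough.extend_apply (fun a b => hkv a b) 0 p)).symm⟩
    obtain ⟨φ₀, hφ₀⟩ := ex h0
    choose φ hφ using fun i => ex (h i)
    refine ⟨φ₀, φ, fun p => ?_⟩
    ext i
    · exact hφ₀ p
    · exact hφ i p

theorem isWebMap_limit {ι : Type*} {l : Filter ι} [l.NeBot] {Γ : ι → U → U} {Φ : U → U}
    (hΓ : ∀ i, IsWebMap (Γ i)) (hΦ : ∀ q, Tendsto (fun i => Γ i q) l (𝓝 (Φ q))) :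
    IsWebMap Φ := by
  have h1 : ∀ p, Tendsto (fun i => (Γ i p).1.1) l (𝓝 (Φ p).1.1) := fun p =>
    (Continuous.tendsto (f := fun x : U => x.1.1) (by fun_prop) _).comp (hΦ p)
  have h2 : ∀ k p, Tendsto (fun i => (Γ i p).1.2 k) l (𝓝 ((Φ p).1.2 k)) := fun k p =>
    (Continuous.tendsto (f := fun x : U => x.1.2 k) (by fun_prop) _).comp (hΦ p)
  refine isWebMap_iff.2 ⟨fun p p' hp => ?_, fun k p p' hp => ?_⟩
  · exact tendsto_nhds_unique (h1 p)
      ((h1 p').congr fun i => ((isWebMap_iff.1 (hΓ i)).1 p p' hp).symm)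
  · exact tendsto_nhds_unique (h2 k p)
      ((h2 k p').congr fun i => ((isWebMap_iff.1 (hΓ i)).2 k p p' hp).symm)

/-- The limits of the maps and of their inverses are smooth, mutually inverse web maps. The equation
`φ_i' f_i = φ₀' f_i(Φ)` survives because first derivatives converge. -/
theorem rigidGroup_webSymmetry (hf : ContDiffOn ℝ ∞ f (Prod.snd '' (U : Set (TX n))))
    (hf0 : ∀ p ∈ U, ∀ i, f p.2 i ≠ 0) {i₀ j₀ : Fin n} (hij : i₀ ≠ j₀)
    (hell : ∀ p ∈ U, ell f i₀ j₀ p.2 ≠ 0) : RigidGroup (webSymmetrySubgroup f U) := by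
  have hH := hasLocalFormula_webSymmetry hf hf0 hij hell
  refine ⟨hH, fun l _ Φ Ψ hΦ hΨ => ?_⟩
  have hsym : ∀ g : webSymmetrySubgroup f U, IsWebSymmetry f g.1 := fun g => g.2
  have hΦs : ContMDiff 𝓘(ℝ, TX n) 𝓘(ℝ, TX n) ∞ Φ := hH.contMDiff_limit (Γ := id) hΦ
  have hΨs : ContMDiff 𝓘(ℝ, TX n) 𝓘(ℝ, TX n) ∞ Ψ := hH.contMDiff_limit (Γ := fun g => g⁻¹) hΨ
  let Θ : U ≃ₜ U :=
    { toFun := Φ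
      invFun := Ψ
      left_inv := hH.apply_limit_symm (Γ := fun g => g⁻¹) hΨ hΦ
      right_inv := hH.apply_limit_symm (Γ := id) hΦ hΨ
      continuous_toFun := hΦs.continuous
      continuous_invFun := hΨs.continuous }
  have hweb : IsWebMap Φ := isWebMap_limit (fun g => (hsym g).web) hΦ
  have hweb' : IsWebMap Ψ := isWebMap_limit (fun g => (hsym g).web_symm) hΨ
  obtain ⟨φ₀, φ, hw⟩ := hweb.exists_eq_webFun
  choose γ₀ γ hγ using fun g => (hsym g).web.exists_eq_webFun
  refine ⟨⟨Θ, isWebSymmetry_of_deriv_mul_eq (φ₀ := φ₀) (φ := φ) hΦs hΨs hw hweb' fun p i => ?_⟩,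
    fun q => rfl⟩
  have hlim : Tendsto (fun g : webSymmetrySubgroup f U =>
      fderiv ℝ (webFun (γ₀ g) (γ g)) p (1, f p.1.2)) l
      (𝓝 (fderiv ℝ (webFun φ₀ φ) p (1, f p.1.2))) :=
    (ContinuousLinearMap.apply ℝ (TX n) ((1, f p.1.2) : TX n)).continuous.continuousAt.tendsto.comp
      (hH.tendsto_fderiv_limit (Γ := id) hΦ hγ hw p)
  have hd := (contDiffAt_of_contMDiffAt hw (hΦs p)).differentiableAt (by simp)
  have hdg : ∀ g, DifferentiableAt ℝ (webFun (γ₀ g) (γ g)) (p : TX n) := fun g =>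
    (contDiffAt_of_contMDiffAt (hγ g) ((hsym g).smooth p)).differentiableAt (by simp)
  rw [fderiv_webFun hd] at hlim
  simp only [fderiv_webFun (hdg _)] at hlim
  have h1 : Tendsto (fun g : webSymmetrySubgroup f U => deriv (γ g i) (p.1.2 i) * f p.1.2 i) l
      (𝓝 (deriv (φ i) (p.1.2 i) * f p.1.2 i)) :=
    (Continuous.tendsto (f := fun v : TX n => v.2 i) (by fun_prop) _).comp hlim
  have h2 : Tendsto (fun g : webSymmetrySubgroup f U => deriv (γ₀ g) p.1.1) l
      (𝓝 (deriv φ₀ p.1.1)) := by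
    simpa [Function.comp_def] using (continuous_fst.tendsto _).comp hlim
  have h3 : Tendsto (fun g : webSymmetrySubgroup f U => f (g.1 p).1.2 i) l
      (𝓝 (f (Φ p).1.2 i)) := by
    have hc : ContinuousAt (fun x : TX n => f x.2 i) (Φ p : TX n) :=
      ContinuousAt.comp (g := fun y => f y i) (f := fun x : TX n => x.2)
        (contDiffAt_pi.1 (contDiffAt_of_mem hf (Φ p).2) i).continuousAt continuousAt_snd
    exact hc.tendsto.comp ((continuous_subtype_val.tendsto _).comp (hΦ p))
  refine tendsto_nhds_unique h1 ((h2.mul h3).congr fun g => ?_)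
  exact ((hsym g).deriv_mul_eq (hγ g) p i).symm

end WebLimit

theorem mainTheorem1 (n : ℕ) (hn : 2 ≤ n) (U : Opens (TX n)) (hU : IsConnected (U : Set (TX n)))
    (f : (Fin n → ℝ) → Fin n → ℝ) (hf : ContDiffOn ℝ ∞ f (Prod.snd '' (U : Set (TX n))))
    (hf0 : ∀ p ∈ U, ∀ i, f p.2 i ≠ 0)
    (hell : ∃ i j : Fin n, i ≠ j ∧ ∀ p ∈ U, ell f i j p.2 ≠ 0) :
    T2Space (WebSymmetryGroup f U) ∧ SecondCountableTopology (WebSymmetryGroup f U) ∧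
    ∃ k : ℕ, k ≤ n + 1 ∧
      ∃ _ : ChartedSpace (EuclideanSpace ℝ (Fin k)) (WebSymmetryGroup f U),
        LieGroup (𝓡 k) ∞ (WebSymmetryGroup f U) ∧
        ContMDiff ((𝓡 k).prod 𝓘(ℝ, TX n)) 𝓘(ℝ, TX n) ∞
          (fun q : WebSymmetryGroup f U × U => q.1.1 q.2) := by
  obtain ⟨i, j, hij, hell⟩ := hell
  have hH := rigidGroup_webSymmetry hf hf0 hij hell
  have : PreconnectedSpace U := isPreconnected_iff_preconnectedSpace.1 hU.isPreconnected
  obtain ⟨o, ho⟩ := hU.nonempty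
  have hτ : IsInducing fun g : WebSymmetryGroup f U => (⟨g.1, g.1.continuous⟩ : C(U, U)) := ⟨rfl⟩
  have hemb := hH.isEmbedding_apply hτ ⟨o, ho⟩
  obtain ⟨k, hk, cs, hLie, hact⟩ := hH.exists_lieGroup hτ ⟨o, ho⟩
  -- Both separation and countability are inherited from `U` through the orbit embedding.
  refine ⟨hemb.t2Space, hemb.secondCountableTopology, k, ?_, cs, hLie, hact⟩
  simpa [add_comm] using hk
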